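/- **Session types.** Types are given by $S ::= \mathsf{end} \mid {?}[S_1,\dots,S_n].S \mid {!}[S_1,\dots,S_n].S \mid \oplus\{l_i:S_i\}_{1\le i\le n} \mid \&\{l_i:S_i\}_{1\le i\le n} \mid \mu X.S \mid X$ and are taken up to renaming of bound variables. We consider closed types in which the labels of each choice are pairwise distinct and which are contractive (no subterm $\mu X_1.\mu X_2\dots\mu X_n.X_1$ with $n\ge 1$). The size is $|\mathsf{end}|=|X|=1$, $|\mu X.T|=|T|+1$, $|{?}[T_1,\dots,T_n].U|=|{!}[T_1,\dots,T_n].U|=\sum_i|T_i|+|U|+1$, $|\oplus\{l_i:T_i\}|=|\&\{l_i:T_i\}|=\sum_i|T_i|+1$. Unfolding is $\mathrm{unfold}(\mu X.T)=\mathrm{unfold}(T[\mu X.T/X])$, and $\mathrm{unfold}(T)=T$ if $T$ is not of the form $\mu X.T'$. **Rules (Gay and Hole).** A judgement $\Gamma\vdash T\le U$ consists of a finite set $\Gamma$ of pairs of types and two types $T,U$. It is checked by the first of the following rules that applies: 1. $\Gamma\vdash T\le U$ if $(T\le U)\in\Gamma$; 2. $\Gamma\vdash\mu X.T\le U$ if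 $\Gamma,\ \mu X.T\le U\vdash \mathrm{unfold}(\mu X.T)\le U$; 3. $\Gamma\vdash T\le\mu X.U$ if $\Gamma,\ T\le\mu X.U\vdash T\le\mathrm{unfold}(\mu X.U)$; 4. $\Gamma\vdash\mathsf{end}\le\mathsf{end}$; 5. $\Gamma\vdash{?}[T_1,\dots,T_n].S\le{?}[U_1,\dots,U_n].S'$ if $\Gamma\vdash T_i\le U_i$ for all $i$ and $\Gamma\vdash S\le S'$; 6. $\Gamma\vdash{!}[T_1,\dots,T_n].S\le{!}[U_1,\dots,U_n].S'$ if $\Gamma\vdash U_i\le T_i$ for all $i$ and $\Gamma\vdash S\le S'$; 7. $\Gamma\vdash\&\{l_i:T_i\}_{i\le m}\le\&\{l_i:U_i\}_{i\le n}$ if $m\le n$ and $\Gamma\vdash T_i\le U_i$ for all $i\le m$; 8. $\Gamma\vdash\oplus\{l_i:T_i\}_{i\le m}\le\oplus\{l_i:U_i\}_{i\le n}$ if $n\le m$ and $\Gamma\vdash T_i\le U_i$ for all $i\le n$. In rules 7 and 8 the branches are matched by their labels. **Memoized algorithm.** To check $T\le U$, the recursive procedure below is called on $\emptyset\vdash T\le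 U$ with the empty table $A$. A call on a judgement $J$ with table $A$ returns $A$ if $J\in A$ (contexts being compared as sets). Otherwise $J$ is added to $A$, the rule that applies to $J$ is determined, and the procedure is called on its premises one after the other, from left to right, each call receiving the table returned by the previous one; the table returned by the last call (or $A\cup\{J\}$, if there are no premises) is returned. If no rule applies, the whole computation stops with failure. The running time is the number of calls of this procedure plus the number of elementary steps of a direct implementation of its auxiliary operations (syntactic equality of types, linear search in lists of assumptions, of memoized judgements and of branches, comparison of contexts as sets, substitution and unfolding, construction of the premises), where visiting one node of a type or one entry of a list, including a comparison of two labels or variables, costs one step. **Theorem.** Let $n=|T|+|U|$. (a) The memoized algorithm halts on all session types $T,U$, with running time $2^{O(n^2)}$: there is a constant $C$ such that for all $T,U$ it halts in at most $2^{Cn^2}$ steps. (b) Its worst-case running time is $\Omega((\sqrt n)!)$, and this already holds for the number of recursive calls: there are $c>0$ and $N$ such that for every $n\ge N$ there are session types $T,U$ with $|T|+|U|=n$ on which the algorithm makes at least $c\cdot(\sqrt n)!$ calls, where $x!=\Gamma_{\mathrm{Euler}}(x+1)$ for real $x\ge 0$. -/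

import Mathlib

/-! ## Binary session types

Labels are natural numbers.  Bound variables are de Bruijn indices, so that types are taken up to
renaming of bound variables: `var 0` refers to the innermost enclosing `mu`. -/

mutual
/-- Session types: `end`, input `?[T₁,…,Tₙ].S`, output `![T₁,…,Tₙ].S`, selection `⊕{lᵢ : Sᵢ}`,
branching `&{lᵢ : Sᵢ}`, recursion `μX.S` and type variables. -/
inductive SType : Type
  | done : SType
  | inp : STypes → SType → SType
  | out : STypes → SType → SType
  | sel : SBranches → SType
  | bra : SBranches → SType
  | mu : SType → SType
  | var : ℕ → SType
/-- Lists of session types (message payloads). -/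
inductive STypes : Type
  | nil : STypes
  | cons : SType → STypes → STypes
/-- Lists of labelled session types. -/
inductive SBranches : Type
  | nil : SBranches
  | cons : ℕ → SType → SBranches → SBranches
end

mutual
/-- The size `|T|` of a session type. -/
def SType.size : SType → ℕ
  | .done => 1
  | .inp Ts S => Ts.size + S.size + 1
  | .out Ts S => Ts.size + S.size + 1
  | .sel Bs => Bs.size + 1
  | .bra Bs => Bs.size + 1
  | .mu S => S.size + 1
  | .var _ => 1
/-- Sum of the sizes of the members. -/
def STypes.size : STypes → ℕ
  | .nil => 0
  | .cons T Ts => T.size + Ts.size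
/-- Sum of the sizes of the members. -/
def SBranches.size : SBranches → ℕ
  | .nil => 0
  | .cons _ T Bs => T.size + Bs.size
end

mutual
/-- Every free variable has an index `< k`. -/
def SType.ClosedBelow : ℕ → SType → Prop
  | _, .done => True
  | k, .inp Ts S => Ts.ClosedBelow k ∧ S.ClosedBelow k
  | k, .out Ts S => Ts.ClosedBelow k ∧ S.ClosedBelow k
  | k, .sel Bs => Bs.ClosedBelow k
  | k, .bra Bs => Bs.ClosedBelow k
  | k, .mu S => S.ClosedBelow (k + 1)
  | k, .var i => i < k
/-- Every free variable has an index `< k`. -/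
def STypes.ClosedBelow : ℕ → STypes → Prop
  | _, .nil => True
  | k, .cons T Ts => T.ClosedBelow k ∧ Ts.ClosedBelow k
/-- Every free variable has an index `< k`. -/
def SBranches.ClosedBelow : ℕ → SBranches → Prop
  | _, .nil => True
  | k, .cons _ T Bs => T.ClosedBelow k ∧ Bs.ClosedBelow k
end

/-- The type is not of the form `μX₂. … μXₙ. X`, where `X` is the variable of index `k` outside
these binders. -/
def SType.NotMuChainTo : ℕ → SType → Prop
  | k, .mu S => S.NotMuChainTo (k + 1)
  | k, .var i => i ≠ k
  | _, _ => True

mutual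
/-- Contractivity: no subterm is of the form `μX₁. μX₂. … μXₙ. X₁` with `n ≥ 1`. -/
def SType.Contractive : SType → Prop
  | .done => True
  | .inp Ts S => Ts.Contractive ∧ S.Contractive
  | .out Ts S => Ts.Contractive ∧ S.Contractive
  | .sel Bs => Bs.Contractive
  | .bra Bs => Bs.Contractive
  | .mu S => S.NotMuChainTo 0 ∧ S.Contractive
  | .var _ => True
/-- Contractivity of every member. -/
def STypes.Contractive : STypes → Prop
  | .nil => True
  | .cons T Ts => T.Contractive ∧ Ts.Contractive
/-- Contractivity of every member. -/
def SBranches.Contractive : SBranches → Prop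
  | .nil => True
  | .cons _ T Bs => T.Contractive ∧ Bs.Contractive
end

/-- The list of labels of a list of branches. -/
def SBranches.labels : SBranches → List ℕ
  | .nil => []
  | .cons l _ Bs => l :: Bs.labels

mutual
/-- In every selection and branching subterm, the labels are pairwise distinct. -/
def SType.DistinctLabels : SType → Prop
  | .done => True
  | .inp Ts S => Ts.DistinctLabels ∧ S.DistinctLabels
  | .out Ts S => Ts.DistinctLabels ∧ S.DistinctLabels
  | .sel Bs => Bs.labels.Nodup ∧ Bs.DistinctLabels
  | .bra Bs => Bs.labels.Nodup ∧ Bs.DistinctLabels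
  | .mu S => S.DistinctLabels
  | .var _ => True
/-- Distinctness of labels inside every member. -/
def STypes.DistinctLabels : STypes → Prop
  | .nil => True
  | .cons T Ts => T.DistinctLabels ∧ Ts.DistinctLabels
/-- Distinctness of labels inside every member. -/
def SBranches.DistinctLabels : SBranches → Prop
  | .nil => True
  | .cons _ T Bs => T.DistinctLabels ∧ Bs.DistinctLabels
end

/-- Proper session types: closed, contractive, with distinct labels in each choice. -/
def SType.IsSessionType (T : SType) : Prop :=
  T.ClosedBelow 0 ∧ T.Contractive ∧ T.DistinctLabels

/-! ## Computations with a step count -/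

/-- A computation of a value of type `α`, with the number `calls` of invocations of the main
recursive procedure and the number `ops` of all other elementary steps that it performs. -/
structure Timed (α : Type) where
  val : α
  calls : ℕ
  ops : ℕ

instance : Monad Timed where
  pure a := ⟨a, 0, 0⟩
  bind x f := ⟨(f x.val).val, x.calls + (f x.val).calls, x.ops + (f x.val).ops⟩

/-- One elementary step. -/
def Timed.tick : Timed Unit := ⟨(), 0, 1⟩

/-- One invocation of the main recursive procedure. -/
def Timed.tickCall : Timed Unit := ⟨(), 1, 0⟩

/-! ## Elementary procedures

Every invocation of one of the recursive procedures below costs one step.  Comparing two labels or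
two variables is part of such a step. -/

mutual
/-- Substitution of the closed type `V` for the variable of index `k`. -/
def SType.subst (V : SType) : ℕ → SType → Timed SType
  | _, .done => do Timed.tick; return .done
  | k, .inp Ts S => do
      Timed.tick
      let Ts' ← STypes.subst V k Ts
      let S' ← SType.subst V k S
      return .inp Ts' S'
  | k, .out Ts S => do
      Timed.tick
      let Ts' ← STypes.subst V k Ts
      let S' ← SType.subst V k S
      return .out Ts' S'
  | k, .sel Bs => do
      Timed.tick
      let Bs' ← SBranches.subst V k Bs
      return .sel Bs'
  | k, .bra Bs => do
      Timed.tick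
      let Bs' ← SBranches.subst V k Bs
      return .bra Bs'
  | k, .mu S => do
      Timed.tick
      let S' ← SType.subst V (k + 1) S
      return .mu S'
  | k, .var i => do Timed.tick; return (if i = k then V else .var i)
/-- Substitution of the closed type `V` for the variable of index `k`. -/
def STypes.subst (V : SType) : ℕ → STypes → Timed STypes
  | _, .nil => do Timed.tick; return .nil
  | k, .cons T Ts => do
      Timed.tick
      let R ← SType.subst V k T
      let Rs ← STypes.subst V k Ts
      return .cons R Rs
/-- Substitution of the closed type `V` for the variable of index `k`. -/
def SBranches.subst (V : SType) : ℕ → SBranches → Timed SBranches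
  | _, .nil => do Timed.tick; return .nil
  | k, .cons l T Bs => do
      Timed.tick
      let R ← SType.subst V k T
      let Rs ← SBranches.subst V k Bs
      return .cons l R Rs
end

/-- The number of leading `μ`s. -/
def SType.muCount : SType → ℕ
  | .mu S => S.muCount + 1
  | _ => 0

/-- At most `k` rounds of the loop: while the type is `μX.S`, replace it by `S[μX.S/X]`. -/
def SType.unfoldLoop : ℕ → SType → Timed SType
  | k + 1, .mu S => do
      Timed.tick
      let R ← SType.subst (.mu S) 0 S
      SType.unfoldLoop k R
  | _, T => do Timed.tick; return T

/-- Unfolding: `unfold(μX.S) = unfold(S[μX.S/X])`, and `unfold(T) = T` otherwise.  For a closed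
contractive type each round of the loop removes one leading `μ`, so that `T.muCount` rounds are
exactly what the recursion performs. -/
def SType.unfold (T : SType) : Timed SType := SType.unfoldLoop T.muCount T

mutual
/-- Syntactic equality of types. -/
def SType.eqTest : SType → SType → Timed Bool
  | .done, .done => do Timed.tick; return true
  | .inp Ts S, .inp Us S' => do
      Timed.tick
      if ← Ts.eqTest Us then S.eqTest S' else return false
  | .out Ts S, .out Us S' => do
      Timed.tick
      if ← Ts.eqTest Us then S.eqTest S' else return false
  | .sel Bs, .sel Cs => do Timed.tick; Bs.eqTest Cs
  | .bra Bs, .bra Cs => do Timed.tick; Bs.eqTest Cs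
  | .mu S, .mu S' => do Timed.tick; S.eqTest S'
  | .var i, .var j => do Timed.tick; return decide (i = j)
  | _, _ => do Timed.tick; return false
/-- Syntactic equality of lists of types. -/
def STypes.eqTest : STypes → STypes → Timed Bool
  | .nil, .nil => do Timed.tick; return true
  | .cons T Ts, .cons U Us => do
      Timed.tick
      if ← T.eqTest U then Ts.eqTest Us else return false
  | _, _ => do Timed.tick; return false
/-- Syntactic equality of lists of labelled types. -/
def SBranches.eqTest : SBranches → SBranches → Timed Bool
  | .nil, .nil => do Timed.tick; return true
  | .cons l T Bs, .cons l' U Cs => do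
      Timed.tick
      if l = l' then
        if ← T.eqTest U then Bs.eqTest Cs else return false
      else return false
  | _, _ => do Timed.tick; return false
end

/-- The branch with label `l`, if there is one. -/
def SBranches.find (l : ℕ) : SBranches → Timed (Option SType)
  | .nil => do Timed.tick; return none
  | .cons l' T Bs => do
      Timed.tick
      if l = l' then return some T else Bs.find l

/-- Is `(T, U)`, read as `T ≤ U`, a member of the list? -/
def memPair (T U : SType) : List (SType × SType) → Timed Bool
  | [] => do Timed.tick; return false
  | (T', U') :: G => do
      Timed.tick
      if ← T.eqTest T' then
        if ← U.eqTest U' then return true else memPair T U G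
      else memPair T U G

/-- Is every member of the first list a member of the second one? -/
def subsetPairs : List (SType × SType) → List (SType × SType) → Timed Bool
  | [], _ => do Timed.tick; return true
  | (T, U) :: G, H => do
      Timed.tick
      if ← memPair T U H then subsetPairs G H else return false

/-- A judgement `Γ ⊢ T ≤ U`.  The list `ctx` stands for the set `Γ` of assumptions. -/
structure Judgement where
  ctx : List (SType × SType)
  lhs : SType
  rhs : SType

/-- Equality of judgements, the contexts being compared as sets. -/
def Judgement.eqTest (J K : Judgement) : Timed Bool := do
  Timed.tick
  if ← J.lhs.eqTest K.lhs then
    if ← J.rhs.eqTest K.rhs then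
      if ← subsetPairs J.ctx K.ctx then subsetPairs K.ctx J.ctx else return false
    else return false
  else return false

/-- Is the judgement a member of the list? -/
def memJudgement (J : Judgement) : List Judgement → Timed Bool
  | [] => do Timed.tick; return false
  | K :: A => do
      Timed.tick
      if ← J.eqTest K then return true else memJudgement J A

/-! ## The rules of the inductive subtyping algorithm -/

/-- The premises `Γ ⊢ Tᵢ ≤ Uᵢ`, followed by those in `rest`; `none` if the lengths differ. -/
def payloadPremises (G : List (SType × SType)) (rest : List Judgement) :
    STypes → STypes → Timed (Option (List Judgement))
  | .nil, .nil => do Timed.tick; return some rest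
  | .cons T Ts, .cons U Us => do
      Timed.tick
      match ← payloadPremises G rest Ts Us with
      | some Js => return some (⟨G, T, U⟩ :: Js)
      | none => return none
  | _, _ => do Timed.tick; return none

/-- For every branch `l : T` of the first list, the premise `Γ ⊢ T ≤ U`, where `l : U` is the
branch with the same label in `Cs`; `none` if a label is missing in `Cs`. -/
def branchPremises (G : List (SType × SType)) (Cs : SBranches) :
    SBranches → Timed (Option (List Judgement))
  | .nil => do Timed.tick; return some []
  | .cons l T Bs => do
      Timed.tick
      match ← Cs.find l with
      | none => return none
      | some U =>
        match ← branchPremises G Cs Bs with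
        | some Js => return some (⟨G, T, U⟩ :: Js)
        | none => return none

/-- For every branch `l : U` of the last list, the premise `Γ ⊢ T ≤ U`, where `l : T` is the
branch with the same label in `Bs`; `none` if a label is missing in `Bs`. -/
def selectPremises (G : List (SType × SType)) (Bs : SBranches) :
    SBranches → Timed (Option (List Judgement))
  | .nil => do Timed.tick; return some []
  | .cons l U Cs => do
      Timed.tick
      match ← Bs.find l with
      | none => return none
      | some T =>
        match ← selectPremises G Bs Cs with
        | some Js => return some (⟨G, T, U⟩ :: Js)
        | none => return none

/-- The premises of the rule that applies to `Γ ⊢ T ≤ U` when `T ≤ U` is not in `Γ`; `none` if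
there is no such rule.  The rules are
* `Γ, μX.T ≤ U ⊢ unfold(μX.T) ≤ U  ⟹  Γ ⊢ μX.T ≤ U`;
* `Γ, T ≤ μX.U ⊢ T ≤ unfold(μX.U)  ⟹  Γ ⊢ T ≤ μX.U` (used if the previous one does not apply);
* `Γ ⊢ end ≤ end`;
* `Γ ⊢ Tᵢ ≤ Uᵢ (all i), Γ ⊢ S ≤ S'  ⟹  Γ ⊢ ?[T₁,…,Tₙ].S ≤ ?[U₁,…,Uₙ].S'`;
* `Γ ⊢ Uᵢ ≤ Tᵢ (all i), Γ ⊢ S ≤ S'  ⟹  Γ ⊢ ![T₁,…,Tₙ].S ≤ ![U₁,…,Uₙ].S'`;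
* `Γ ⊢ Tᵢ ≤ Uᵢ (i ≤ m), m ≤ n  ⟹  Γ ⊢ &{lᵢ : Tᵢ}_{i ≤ m} ≤ &{lᵢ : Uᵢ}_{i ≤ n}`;
* `Γ ⊢ Tᵢ ≤ Uᵢ (i ≤ n), n ≤ m  ⟹  Γ ⊢ ⊕{lᵢ : Tᵢ}_{i ≤ m} ≤ ⊕{lᵢ : Uᵢ}_{i ≤ n}`. -/
def premises (G : List (SType × SType)) : SType → SType → Timed (Option (List Judgement))
  | .mu S, U => do
      Timed.tick
      let T' ← SType.unfold (.mu S)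
      return some [⟨(.mu S, U) :: G, T', U⟩]
  | T, .mu S => do
      Timed.tick
      let U' ← SType.unfold (.mu S)
      return some [⟨(T, .mu S) :: G, T, U'⟩]
  | .done, .done => do Timed.tick; return some []
  | .inp Ts S, .inp Us S' => do Timed.tick; payloadPremises G [⟨G, S, S'⟩] Ts Us
  | .out Ts S, .out Us S' => do Timed.tick; payloadPremises G [⟨G, S, S'⟩] Us Ts
  | .bra Bs, .bra Cs => do Timed.tick; branchPremises G Cs Bs
  | .sel Bs, .sel Cs => do Timed.tick; selectPremises G Bs Cs
  | _, _ => do Timed.tick; return none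

/-! ## The memoized algorithm -/

/-- Outcome of a call: success with the extended memo table, failure, or no answer because the
allowed depth of recursion was exceeded. -/
inductive Outcome : Type
  | ok : List Judgement → Outcome
  | fail : Outcome
  | depthExceeded : Outcome

/-- Apply a checking procedure to all judgements of a list from left to right, passing the memo
table on, up to the first one that is not checked successfully. -/
def checkAll (f : List Judgement → Judgement → Timed Outcome) :
    List Judgement → List Judgement → Timed Outcome
  | A, [] => do Timed.tick; return .ok A
  | A, J :: Js => do
      Timed.tick
      match ← f A J with
      | .ok A' => checkAll f A' Js
      | .fail => return .fail
      | .depthExceeded => return .depthExceeded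

/-- The memoized version of Gay and Hole's algorithm.  The memo table `A` contains the judgements
that have been encountered; a judgement that is in the table is not examined again.  The first
argument bounds the depth of recursion. -/
def memoSubtype : ℕ → List Judgement → Judgement → Timed Outcome
  | 0, _, _ => return .depthExceeded
  | d + 1, A, J => do
      Timed.tickCall
      if ← memJudgement J A then
        return .ok A
      else if ← memPair J.lhs J.rhs J.ctx then
        return .ok (J :: A)
      else
        match ← premises J.ctx J.lhs J.rhs with
        | some Js => checkAll (memoSubtype d) (J :: A) Js
        | none => return .fail

/-- On input `(T, U)`, that is, on the judgement `∅ ⊢ T ≤ U` with the empty memo table, the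
memoized algorithm halts after `calls` calls of its recursive procedure and `ops` other elementary
steps.  (A larger bound on the depth does not change a computation that has an answer, so that
`calls` and `ops` are determined by `T` and `U`.) -/
def MemoRunsIn (T U : SType) (calls ops : ℕ) : Prop :=
  ∃ (d : ℕ) (r : Outcome), r ≠ .depthExceeded ∧ memoSubtype d [] ⟨[], T, U⟩ = ⟨r, calls, ops⟩

/-! ## Cost of the elementary procedures -/

-- Upper bound. Every type met during a run is a subterm of `T` or `U` in which each bound variable
-- has been replaced by the recursive type that binds it. There is one such type per node, so they
-- form a family `W` of n members (`SType.length_reach`, `unfoldClosed_reach`). Each level of `μ`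
-- multiplies the size by at most n, so the members have size at most n^n ≤ 2^(n²) =: Z
-- (`SType.size_le_of_mem_reach`). A judgement consists of two members of `W` and a set of pairs of
-- members, so a table of inequivalent judgements has at most n²·2^(n²) ≤ Z² entries
-- (`IsTable.length_le`). A call that gets as far as its premises enters a new judgement, which has
-- at most Z premises. Charging these calls to that entry bounds the number of calls by 1 + Z·Z²,
-- and the work charged to one call is polynomial in Z (`memoSubtype_controlled`). Everything
-- together is at most Z^15. Recursion terminates because a `μ` rule adds a fresh pair to a context
-- of bounded length, while the other rules keep the context and shrink the types.
--
-- Lower bound. In `rowType p ≤ colType r p` the label 0 lowers the index of the left type and the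
-- label 1 that of the right one, so the run walks through the lattice from (p, p). At each point
-- both `μ` rules record the point in the context. The first p steps may be chosen freely, and the
-- context together with the end point determines the path (`eq_of_pathJudgement_equiv`).
-- Memoization therefore never merges two of the 2^p paths of length p. The run cannot fail, and
-- after success the table is closed under premises, so it contains all these judgements
-- (`ClosedTable.exists_pathJudgement`); one call adds at most one entry. Since n = 6p + 6 + r with
-- r < 6, this gives about 2^(n/6) calls, which eventually exceeds (√n)! (`gamma_sqrt_le_two_pow`).

namespace Timed

variable {α β : Type}

@[simp] theorem val_pure (a : α) : (pure a : Timed α).val = a := rfl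
@[simp] theorem calls_pure (a : α) : (pure a : Timed α).calls = 0 := rfl
@[simp] theorem ops_pure (a : α) : (pure a : Timed α).ops = 0 := rfl
@[simp] theorem val_bind (x : Timed α) (f : α → Timed β) : (x >>= f).val = (f x.val).val := rfl
@[simp] theorem calls_bind (x : Timed α) (f : α → Timed β) :
    (x >>= f).calls = x.calls + (f x.val).calls := rfl
@[simp] theorem ops_bind (x : Timed α) (f : α → Timed β) :
    (x >>= f).ops = x.ops + (f x.val).ops := rfl
@[simp] theorem calls_tick : tick.calls = 0 := rfl
@[simp] theorem ops_tick : tick.ops = 1 := rfl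
@[simp] theorem calls_tickCall : tickCall.calls = 1 := rfl
@[simp] theorem ops_tickCall : tickCall.ops = 0 := rfl

end Timed

theorem SType.size_pos (T : SType) : 0 < T.size := by
  cases T <;> simp [SType.size]

mutual
theorem SType.subst_calls (V : SType) : ∀ (T : SType) (k : ℕ), (SType.subst V k T).calls = 0
  | .done, k => by simp [SType.subst]
  | .inp Ts S, k => by simp [SType.subst, STypes.subst_calls V Ts, SType.subst_calls V S]
  | .out Ts S, k => by simp [SType.subst, STypes.subst_calls V Ts, SType.subst_calls V S]
  | .sel Bs, k => by simp [SType.subst, SBranches.subst_calls V Bs]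
  | .bra Bs, k => by simp [SType.subst, SBranches.subst_calls V Bs]
  | .mu S, k => by simp [SType.subst, SType.subst_calls V S]
  | .var i, k => by simp [SType.subst]
theorem STypes.subst_calls (V : SType) : ∀ (Ts : STypes) (k : ℕ), (STypes.subst V k Ts).calls = 0
  | .nil, k => by simp [STypes.subst]
  | .cons T Ts, k => by simp [STypes.subst, STypes.subst_calls V Ts, SType.subst_calls V T]
theorem SBranches.subst_calls (V : SType) :
    ∀ (Bs : SBranches) (k : ℕ), (SBranches.subst V k Bs).calls = 0
  | .nil, k => by simp [SBranches.subst]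
  | .cons l T Bs, k => by
    simp [SBranches.subst, SBranches.subst_calls V Bs, SType.subst_calls V T]
end

mutual
-- Size counts type nodes only, so each node also has to pay for the list cell that holds it and for
-- the end of its own list. The reserve of one step for types pays for that cell, or for the loop
-- step of a caller.
theorem SType.subst_ops (V : SType) :
    ∀ (T : SType) (k : ℕ), (SType.subst V k T).ops + 1 ≤ 3 * T.size
  | .done, k => by simp [SType.subst, SType.size]
  | .inp Ts S, k => by
    have := STypes.subst_ops V Ts k
    have := SType.subst_ops V S k
    simp [SType.subst, SType.size]; omega
  | .out Ts S, k => by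
    have := STypes.subst_ops V Ts k
    have := SType.subst_ops V S k
    simp [SType.subst, SType.size]; omega
  | .sel Bs, k => by
    have := SBranches.subst_ops V Bs k
    simp [SType.subst, SType.size]; omega
  | .bra Bs, k => by
    have := SBranches.subst_ops V Bs k
    simp [SType.subst, SType.size]; omega
  | .mu S, k => by
    have := SType.subst_ops V S (k + 1)
    simp [SType.subst, SType.size]; omega
  | .var i, k => by simp [SType.subst, SType.size]
theorem STypes.subst_ops (V : SType) :
    ∀ (Ts : STypes) (k : ℕ), (STypes.subst V k Ts).ops ≤ 3 * Ts.size + 1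
  | .nil, k => by simp [STypes.subst, STypes.size]
  | .cons T Ts, k => by
    have := STypes.subst_ops V Ts k
    have := SType.subst_ops V T k
    simp [STypes.subst, STypes.size]; omega
theorem SBranches.subst_ops (V : SType) :
    ∀ (Bs : SBranches) (k : ℕ), (SBranches.subst V k Bs).ops ≤ 3 * Bs.size + 1
  | .nil, k => by simp [SBranches.subst, SBranches.size]
  | .cons l T Bs, k => by
    have := SBranches.subst_ops V Bs k
    have := SType.subst_ops V T k
    simp [SBranches.subst, SBranches.size]; omega
end

mutual
-- The comparison descends both types in parallel and stops at the first difference, so its cost is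
-- bounded by the size of the first argument alone.
theorem SType.eqTest_spec : ∀ T U : SType,
    (T.eqTest U).calls = 0 ∧ (T.eqTest U).ops + 1 ≤ 3 * T.size ∧ ((T.eqTest U).val = true ↔ T = U)
  | .done, U => by cases U <;> simp [SType.eqTest, SType.size]
  | .inp Ts S, U => by
    cases U with
    | inp Us S' =>
      obtain ⟨h1, h2, h3⟩ := STypes.eqTest_spec Ts Us
      obtain ⟨k1, k2, k3⟩ := SType.eqTest_spec S S'
      simp only [SType.eqTest, SType.size, Timed.calls_bind, Timed.ops_bind, Timed.val_bind]
      split <;> simp_all <;> omega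
    | _ => simp [SType.eqTest, SType.size]; omega
  | .out Ts S, U => by
    cases U with
    | out Us S' =>
      obtain ⟨h1, h2, h3⟩ := STypes.eqTest_spec Ts Us
      obtain ⟨k1, k2, k3⟩ := SType.eqTest_spec S S'
      simp only [SType.eqTest, SType.size, Timed.calls_bind, Timed.ops_bind, Timed.val_bind]
      split <;> simp_all <;> omega
    | _ => simp [SType.eqTest, SType.size]; omega
  | .sel Bs, U => by
    cases U with
    | sel Cs =>
      obtain ⟨h1, h2, h3⟩ := SBranches.eqTest_spec Bs Cs
      simp [SType.eqTest, SType.size, h1, h3]; omega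
    | _ => simp [SType.eqTest, SType.size]; omega
  | .bra Bs, U => by
    cases U with
    | bra Cs =>
      obtain ⟨h1, h2, h3⟩ := SBranches.eqTest_spec Bs Cs
      simp [SType.eqTest, SType.size, h1, h3]; omega
    | _ => simp [SType.eqTest, SType.size]; omega
  | .mu S, U => by
    cases U with
    | mu S' =>
      obtain ⟨h1, h2, h3⟩ := SType.eqTest_spec S S'
      simp [SType.eqTest, SType.size, h1, h3]; omega
    | _ => simp [SType.eqTest, SType.size]; omega
  | .var i, U => by cases U <;> simp [SType.eqTest, SType.size]
theorem STypes.eqTest_spec : ∀ Ts Us : STypes,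
    (Ts.eqTest Us).calls = 0 ∧ (Ts.eqTest Us).ops ≤ 3 * Ts.size + 1 ∧
      ((Ts.eqTest Us).val = true ↔ Ts = Us)
  | .nil, Us => by cases Us <;> simp [STypes.eqTest, STypes.size]
  | .cons T Ts, Us => by
    cases Us with
    | nil => simp [STypes.eqTest, STypes.size]
    | cons U Us =>
      obtain ⟨h1, h2, h3⟩ := SType.eqTest_spec T U
      obtain ⟨k1, k2, k3⟩ := STypes.eqTest_spec Ts Us
      simp only [STypes.eqTest, STypes.size, Timed.calls_bind, Timed.ops_bind, Timed.val_bind]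
      split <;> simp_all <;> omega
theorem SBranches.eqTest_spec : ∀ Bs Cs : SBranches,
    (Bs.eqTest Cs).calls = 0 ∧ (Bs.eqTest Cs).ops ≤ 3 * Bs.size + 1 ∧
      ((Bs.eqTest Cs).val = true ↔ Bs = Cs)
  | .nil, Cs => by cases Cs <;> simp [SBranches.eqTest, SBranches.size]
  | .cons l T Bs, Cs => by
    cases Cs with
    | nil => simp [SBranches.eqTest, SBranches.size]
    | cons l' U Cs =>
      obtain ⟨h1, h2, h3⟩ := SType.eqTest_spec T U
      obtain ⟨k1, k2, k3⟩ := SBranches.eqTest_spec Bs Cs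
      simp only [SBranches.eqTest, SBranches.size, Timed.calls_bind, Timed.ops_bind, Timed.val_bind]
      split
      · simp only [Timed.calls_bind, Timed.ops_bind, Timed.val_bind]
        split <;> simp_all <;> omega
      · simp_all
end

theorem memPair_calls (T U : SType) (G : List (SType × SType)) : (memPair T U G).calls = 0 := by
  induction G with
  | nil => simp [memPair]
  | cons P G ih =>
    obtain ⟨T', U'⟩ := P
    simp only [memPair, Timed.calls_bind, (SType.eqTest_spec _ _).1]
    split
    · simp only [Timed.calls_bind, (SType.eqTest_spec _ _).1]
      split <;> simp [ih]
    · simp [ih]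

theorem memPair_val (T U : SType) (G : List (SType × SType)) :
    (memPair T U G).val = true ↔ (T, U) ∈ G := by
  induction G with
  | nil => simp [memPair]
  | cons P G ih =>
    obtain ⟨T', U'⟩ := P
    have h1 := (SType.eqTest_spec T T').2.2
    have h2 := (SType.eqTest_spec U U').2.2
    simp only [memPair, Timed.val_bind]
    split
    · simp only [Timed.val_bind]
      split <;> simp_all
    · simp_all

/-- The reserve of one step in the cost of `SType.eqTest` absorbs the step for the list entry, so an
entry costs at most 3 times the size of the pair. -/
theorem memPair_ops (T U : SType) (G : List (SType × SType)) :
    (memPair T U G).ops ≤ 1 + G.length * (3 * (T.size + U.size)) := by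
  induction G with
  | nil => simp [memPair]
  | cons P G ih =>
    obtain ⟨T', U'⟩ := P
    have h1 := (SType.eqTest_spec T T').2.1
    have h2 := (SType.eqTest_spec U U').2.1
    simp only [memPair, Timed.ops_bind, List.length_cons, add_mul, one_mul, Timed.ops_tick]
    split
    · simp only [Timed.ops_bind]
      split
      · simp; omega
      · omega
    · omega

theorem subsetPairs_calls (G H : List (SType × SType)) : (subsetPairs G H).calls = 0 := by
  induction G with
  | nil => simp [subsetPairs]
  | cons P G ih =>
    obtain ⟨T, U⟩ := P
    simp only [subsetPairs, Timed.calls_bind, memPair_calls]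
    split <;> simp [ih]

theorem subsetPairs_val (G H : List (SType × SType)) :
    (subsetPairs G H).val = true ↔ G ⊆ H := by
  induction G with
  | nil => simp [subsetPairs]
  | cons P G ih =>
    obtain ⟨T, U⟩ := P
    have h := memPair_val T U H
    simp only [subsetPairs, Timed.val_bind]
    split <;> simp_all

theorem subsetPairs_ops (G H : List (SType × SType)) {Z : ℕ}
    (hG : ∀ P ∈ G, P.1.size ≤ Z ∧ P.2.size ≤ Z) :
    (subsetPairs G H).ops ≤ 1 + G.length * (2 + H.length * (6 * Z)) := by
  induction G with
  | nil => simp [subsetPairs]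
  | cons P G ih =>
    obtain ⟨T, U⟩ := P
    have h := memPair_ops T U H
    have hTU := hG (T, U) (by simp)
    have h' : H.length * (3 * (T.size + U.size)) ≤ H.length * (6 * Z) :=
      Nat.mul_le_mul_left _ (by simp at hTU; omega)
    have ih := ih fun P hP => hG P (by simp [hP])
    simp only [subsetPairs, Timed.ops_bind, List.length_cons, add_mul, one_mul, Timed.ops_tick]
    generalize G.length * (2 + H.length * (6 * Z)) = Y at *
    split
    · omega
    · simp; omega

/-- Two judgements are equivalent if they differ only in the representation of the context. -/
def Judgement.Equiv (J K : Judgement) : Prop :=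
  J.lhs = K.lhs ∧ J.rhs = K.rhs ∧ J.ctx ⊆ K.ctx ∧ K.ctx ⊆ J.ctx

theorem Judgement.Equiv.refl (J : Judgement) : J.Equiv J :=
  ⟨rfl, rfl, List.Subset.refl _, List.Subset.refl _⟩

theorem Judgement.Equiv.symm {J K : Judgement} (h : J.Equiv K) : K.Equiv J :=
  ⟨h.1.symm, h.2.1.symm, h.2.2.2, h.2.2.1⟩

theorem Judgement.Equiv.trans {J K L : Judgement} (h : J.Equiv K) (h' : K.Equiv L) : J.Equiv L :=
  ⟨h.1.trans h'.1, h.2.1.trans h'.2.1, List.Subset.trans h.2.2.1 h'.2.2.1,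
    List.Subset.trans h'.2.2.2 h.2.2.2⟩

theorem Judgement.eqTest_calls (J K : Judgement) : (J.eqTest K).calls = 0 := by
  simp only [Judgement.eqTest, Timed.calls_bind, (SType.eqTest_spec _ _).1]
  split
  · simp only [Timed.calls_bind, (SType.eqTest_spec _ _).1]
    split
    · simp only [Timed.calls_bind, subsetPairs_calls]
      split <;> simp [subsetPairs_calls]
    · simp
  · simp

theorem Judgement.eqTest_val (J K : Judgement) : (J.eqTest K).val = true ↔ J.Equiv K := by
  have h1 := (SType.eqTest_spec J.lhs K.lhs).2.2
  have h2 := (SType.eqTest_spec J.rhs K.rhs).2.2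
  have h3 := subsetPairs_val J.ctx K.ctx
  have h4 := subsetPairs_val K.ctx J.ctx
  simp only [Judgement.eqTest, Judgement.Equiv, Timed.val_bind]
  split
  · simp only [Timed.val_bind]
    split
    · simp only [Timed.val_bind]
      split <;> simp_all
    · simp_all
  · simp_all

/-- All types in the judgement have size at most `Z`, and the context has at most `L` entries. -/
structure Judgement.Bounded (Z L : ℕ) (J : Judgement) : Prop where
  lhs : J.lhs.size ≤ Z
  rhs : J.rhs.size ≤ Z
  ctx : ∀ P ∈ J.ctx, P.1.size ≤ Z ∧ P.2.size ≤ Z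
  length : J.ctx.length ≤ L

theorem Judgement.eqTest_ops {J K : Judgement} {Z L : ℕ} (hJ : J.Bounded Z L)
    (hK : K.Bounded Z L) : (J.eqTest K).ops ≤ 3 + 6 * Z + 2 * (L * (2 + L * (6 * Z))) := by
  have key : ∀ {J K : Judgement}, J.Bounded Z L → K.Bounded Z L →
      (subsetPairs J.ctx K.ctx).ops ≤ 1 + L * (2 + L * (6 * Z)) := fun {J K} hJ hK =>
    (subsetPairs_ops J.ctx K.ctx hJ.ctx).trans (by
      have := hJ.length
      have := hK.length
      gcongr)
  have h1 := (SType.eqTest_spec J.lhs K.lhs).2.1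
  have h2 := (SType.eqTest_spec J.rhs K.rhs).2.1
  have h3 := key hJ hK
  have h4 := key hK hJ
  have := hJ.lhs
  have := hJ.rhs
  simp only [Judgement.eqTest, Timed.ops_bind, Timed.ops_tick]
  generalize L * (2 + L * (6 * Z)) = Y at *
  split
  · simp only [Timed.ops_bind]
    split
    · simp only [Timed.ops_bind]
      split
      · omega
      · simp; omega
    · simp; omega
  · simp; omega

theorem memJudgement_calls (J : Judgement) (A : List Judgement) : (memJudgement J A).calls = 0 := by
  induction A with
  | nil => simp [memJudgement]
  | cons K A ih =>
    simp only [memJudgement, Timed.calls_bind, Judgement.eqTest_calls]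
    split <;> simp [ih]

theorem memJudgement_val (J : Judgement) (A : List Judgement) :
    (memJudgement J A).val = true ↔ ∃ K ∈ A, J.Equiv K := by
  induction A with
  | nil => simp [memJudgement]
  | cons K A ih =>
    have := J.eqTest_val K
    simp only [memJudgement, Timed.val_bind]
    split <;> simp_all

theorem memJudgement_ops {J : Judgement} {A : List Judgement} {Z L : ℕ} (hJ : J.Bounded Z L)
    (hA : ∀ K ∈ A, K.Bounded Z L) :
    (memJudgement J A).ops ≤ 1 + A.length * (4 + 6 * Z + 2 * (L * (2 + L * (6 * Z)))) := by
  induction A with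
  | nil => simp [memJudgement]
  | cons K A ih =>
    have h := Judgement.eqTest_ops hJ (hA K (by simp))
    have ih := ih fun K hK => hA K (by simp [hK])
    simp only [memJudgement, Timed.ops_bind, List.length_cons, add_mul A.length, one_mul,
      Timed.ops_tick]
    generalize A.length * (4 + 6 * Z + 2 * (L * (2 + L * (6 * Z)))) = Y at *
    generalize L * (2 + L * (6 * Z)) = Y' at *
    split
    · simp; omega
    · omega

/-! ## Components, premises and closed families of types -/

/-- The members of a list of types. -/
def STypes.toList : STypes → List SType
  | .nil => []
  | .cons T Ts => T :: Ts.toList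

/-- The types of a list of branches. -/
def SBranches.types : SBranches → List SType
  | .nil => []
  | .cons _ T Bs => T :: Bs.types

/-- The immediate components of a type that is not recursive. -/
def SType.components : SType → List SType
  | .inp Ts S => S :: Ts.toList
  | .out Ts S => S :: Ts.toList
  | .sel Bs => Bs.types
  | .bra Bs => Bs.types
  | _ => []

theorem STypes.size_le_of_mem {X : SType} : ∀ {Ts : STypes}, X ∈ Ts.toList → X.size ≤ Ts.size
  | .nil, h => by simp [STypes.toList] at h
  | .cons T Ts, h => by
    rcases List.mem_cons.1 h with rfl | h
    · simp [STypes.size]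
    · have := STypes.size_le_of_mem h
      simp [STypes.size]; omega

theorem SBranches.size_le_of_mem {X : SType} :
    ∀ {Bs : SBranches}, X ∈ Bs.types → X.size ≤ Bs.size
  | .nil, h => by simp [SBranches.types] at h
  | .cons l T Bs, h => by
    rcases List.mem_cons.1 h with rfl | h
    · simp [SBranches.size]
    · have := SBranches.size_le_of_mem h
      simp [SBranches.size]; omega

theorem SType.size_lt_of_mem_components {X T : SType} (h : X ∈ T.components) :
    X.size < T.size := by
  cases T with
  | inp Ts S | out Ts S =>
    rcases List.mem_cons.1 h with rfl | h
    · simp [SType.size]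
    · have := STypes.size_le_of_mem h
      simp [SType.size]; omega
  | sel Bs | bra Bs =>
    have := SBranches.size_le_of_mem h
    simp [SType.size]; omega
  | _ => simp [SType.components] at h

theorem SType.muCount_le_size (T : SType) : T.muCount ≤ T.size := by
  match T with
  | .mu S =>
    have := SType.muCount_le_size S
    simp [SType.muCount, SType.size]; omega
  | .done | .inp _ _ | .out _ _ | .sel _ | .bra _ | .var _ => simp [SType.muCount]

/-- A family of types of size at most `Z` that is closed under taking components and under
replacing `μX.S` by `S[μX.S/X]`. -/
structure UnfoldClosed (W : List SType) (Z : ℕ) : Prop where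
  components : ∀ T ∈ W, ∀ X ∈ T.components, X ∈ W
  subst : ∀ S, .mu S ∈ W → (SType.subst (.mu S) 0 S).val ∈ W
  size_le : ∀ T ∈ W, T.size ≤ Z

theorem SType.unfoldLoop_calls (k : ℕ) (T : SType) : (SType.unfoldLoop k T).calls = 0 := by
  induction k generalizing T with
  | zero => simp [SType.unfoldLoop]
  | succ k ih => cases T <;> simp [SType.unfoldLoop, ih, SType.subst_calls]

theorem UnfoldClosed.unfoldLoop {W : List SType} {Z : ℕ} (hW : UnfoldClosed W Z) (k : ℕ)
    {T : SType} (hT : T ∈ W) :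
    (SType.unfoldLoop k T).val ∈ W ∧ (SType.unfoldLoop k T).ops ≤ 1 + k * (3 * Z) := by
  induction k generalizing T with
  | zero => simpa [SType.unfoldLoop] using hT
  | succ k ih =>
    cases T with
    | mu S =>
      have h1 := ih (hW.subst S hT)
      have h2 := SType.subst_ops (.mu S) S 0
      have h3 := hW.size_le _ hT
      simp only [SType.size] at h3
      -- One round costs at most 3 * Z: the substitution runs over the body only, and its reserve
      -- pays for the step of the loop.
      simp only [SType.unfoldLoop, Timed.val_bind, Timed.ops_bind, Timed.ops_tick, add_mul, one_mul]
      exact ⟨h1.1, by omega⟩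
    | _ => simpa [SType.unfoldLoop] using hT

theorem UnfoldClosed.unfold {W : List SType} {Z : ℕ} (hW : UnfoldClosed W Z)
    {T : SType} (hT : T ∈ W) : T.unfold.val ∈ W ∧ T.unfold.ops ≤ 1 + Z * (3 * Z) := by
  have h := hW.unfoldLoop T.muCount hT
  refine ⟨h.1, h.2.trans ?_⟩
  have := T.muCount_le_size.trans (hW.size_le T hT)
  gcongr

theorem SBranches.find_spec (l : ℕ) (Bs : SBranches) :
    (Bs.find l).calls = 0 ∧ (Bs.find l).ops ≤ 1 + Bs.size ∧
      ∀ T, (Bs.find l).val = some T → T ∈ Bs.types := by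
  match Bs with
  | .nil => simp [SBranches.find]
  | .cons l' T Bs =>
    obtain ⟨h1, h2, h3⟩ := SBranches.find_spec l Bs
    have := T.size_pos
    simp only [SBranches.find, Timed.calls_bind, Timed.ops_bind, Timed.val_bind, SBranches.size,
      SBranches.types, Timed.calls_tick, Timed.ops_tick]
    split
    · simp
    · exact ⟨by omega, by omega, fun U hU => List.mem_cons_of_mem _ (h3 U hU)⟩

theorem payloadPremises_spec (G : List (SType × SType)) (rest : List Judgement) (Ts Us : STypes) :
    (payloadPremises G rest Ts Us).calls = 0 ∧
    (payloadPremises G rest Ts Us).ops ≤ 1 + Ts.size ∧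
    ∀ Js, (payloadPremises G rest Ts Us).val = some Js →
      Js.length ≤ Ts.size + rest.length ∧
      ∀ J ∈ Js, (J.ctx = G ∧ J.lhs ∈ Ts.toList ∧ J.rhs ∈ Us.toList) ∨ J ∈ rest := by
  match Ts, Us with
  | .nil, .nil => simp +contextual [payloadPremises]
  | .nil, .cons U Us => simp [payloadPremises]
  | .cons T Ts, .nil => simp [payloadPremises]
  | .cons T Ts, .cons U Us =>
    obtain ⟨h1, h2, h3⟩ := payloadPremises_spec G rest Ts Us
    have := T.size_pos
    simp only [payloadPremises, Timed.calls_bind, Timed.ops_bind, Timed.val_bind, STypes.size,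
      STypes.toList, Timed.calls_tick, Timed.ops_tick]
    split
    · rename_i Js h
      obtain ⟨h4, h5⟩ := h3 Js h
      refine ⟨by simpa using h1, by simp; omega, ?_⟩
      simp only [Timed.val_pure, Option.some.injEq, forall_eq', List.length_cons, List.mem_cons]
      refine ⟨by omega, ?_⟩
      rintro J (rfl | hJ)
      · simp
      · have := h5 J hJ
        tauto
    · exact ⟨by simpa using h1, by simp; omega, by simp⟩

theorem branchPremises_spec (G : List (SType × SType)) (Cs Bs : SBranches) :
    (branchPremises G Cs Bs).calls = 0 ∧
    (branchPremises G Cs Bs).ops ≤ 1 + Bs.size * (2 + Cs.size) ∧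
    ∀ Js, (branchPremises G Cs Bs).val = some Js → Js.length ≤ Bs.size ∧
      ∀ J ∈ Js, J.ctx = G ∧ J.lhs ∈ Bs.types ∧ J.rhs ∈ Cs.types := by
  match Bs with
  | .nil => simp [branchPremises]
  | .cons l T Bs =>
    obtain ⟨h1, h2, h3⟩ := branchPremises_spec G Cs Bs
    obtain ⟨k1, k2, k3⟩ := SBranches.find_spec l Cs
    have := T.size_pos
    have hle : (1 + Bs.size) * (2 + Cs.size) ≤ (T.size + Bs.size) * (2 + Cs.size) := by gcongr; omega
    rw [add_mul, one_mul] at hle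
    simp only [branchPremises, Timed.calls_bind, Timed.ops_bind, Timed.val_bind, SBranches.size,
      SBranches.types, Timed.calls_tick, Timed.ops_tick]
    generalize Bs.size * (2 + Cs.size) = Y at *
    split
    · exact ⟨by simpa using k1, by simp; omega, by simp⟩
    · rename_i U hU
      simp only [Timed.calls_bind, Timed.ops_bind, Timed.val_bind]
      split
      · rename_i Js h
        obtain ⟨h4, h5⟩ := h3 Js h
        refine ⟨by simp [h1, k1], by simp; omega, ?_⟩
        simp only [Timed.val_pure, Option.some.injEq, forall_eq', List.length_cons, List.mem_cons]
        refine ⟨by omega, ?_⟩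
        rintro J (rfl | hJ)
        · simp [k3 U hU]
        · have := h5 J hJ
          tauto
      · exact ⟨by simp [h1, k1], by simp; omega, by simp⟩

theorem selectPremises_spec (G : List (SType × SType)) (Bs Cs : SBranches) :
    (selectPremises G Bs Cs).calls = 0 ∧
    (selectPremises G Bs Cs).ops ≤ 1 + Cs.size * (2 + Bs.size) ∧
    ∀ Js, (selectPremises G Bs Cs).val = some Js → Js.length ≤ Cs.size ∧
      ∀ J ∈ Js, J.ctx = G ∧ J.lhs ∈ Bs.types ∧ J.rhs ∈ Cs.types := by
  match Cs with
  | .nil => simp [selectPremises]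
  | .cons l U Cs =>
    obtain ⟨h1, h2, h3⟩ := selectPremises_spec G Bs Cs
    obtain ⟨k1, k2, k3⟩ := SBranches.find_spec l Bs
    have := U.size_pos
    have hle : (1 + Cs.size) * (2 + Bs.size) ≤ (U.size + Cs.size) * (2 + Bs.size) := by gcongr; omega
    rw [add_mul, one_mul] at hle
    simp only [selectPremises, Timed.calls_bind, Timed.ops_bind, Timed.val_bind, SBranches.size,
      SBranches.types, Timed.calls_tick, Timed.ops_tick]
    generalize Cs.size * (2 + Bs.size) = Y at *
    split
    · exact ⟨by simpa using k1, by simp; omega, by simp⟩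
    · rename_i T hT
      simp only [Timed.calls_bind, Timed.ops_bind, Timed.val_bind]
      split
      · rename_i Js h
        obtain ⟨h4, h5⟩ := h3 Js h
        refine ⟨by simp [h1, k1], by simp; omega, ?_⟩
        simp only [Timed.val_pure, Option.some.injEq, forall_eq', List.length_cons, List.mem_cons]
        refine ⟨by omega, ?_⟩
        rintro J (rfl | hJ)
        · simp [k3 T hT]
        · have := h5 J hJ
          tauto
      · exact ⟨by simp [h1, k1], by simp; omega, by simp⟩

-- The premises of a judgement: their cost, number and shape

theorem premises_mu_left (G : List (SType × SType)) (S U : SType) :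
    premises G (.mu S) U = do
      Timed.tick
      let T' ← SType.unfold (.mu S)
      return some [⟨(.mu S, U) :: G, T', U⟩] := by
  simp [premises]

theorem premises_mu_right (G : List (SType × SType)) {T : SType} (hT : ∀ S, T ≠ .mu S)
    (S : SType) :
    premises G T (.mu S) = do
      Timed.tick
      let U' ← SType.unfold (.mu S)
      return some [⟨(T, .mu S) :: G, T, U'⟩] := by
  cases T <;> simp_all [premises]

theorem premises_calls (G : List (SType × SType)) (T U : SType) :
    (premises G T U).calls = 0 := by
  have hu : ∀ T, (SType.unfold T).calls = 0 := fun T => SType.unfoldLoop_calls _ T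
  by_cases hT : ∃ S, T = .mu S
  · obtain ⟨S, rfl⟩ := hT
    simp [premises_mu_left, hu]
  · by_cases hU : ∃ S, U = .mu S
    · obtain ⟨S, rfl⟩ := hU
      simp [premises_mu_right G (by simpa using hT), hu]
    · cases T <;> cases U <;> simp_all [premises, (payloadPremises_spec _ _ _ _).1,
        (branchPremises_spec _ _ _).1, (selectPremises_spec _ _ _).1]

/-- The shape of a premise of a judgement `G ⊢ T ≤ U` that has no `μ` at the top. -/
structure IsComponentPremise (G : List (SType × SType)) (T U : SType) (J : Judgement) : Prop where
  ctx : J.ctx = G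
  mem : J.lhs ∈ T.components ∧ J.rhs ∈ U.components ∨ J.lhs ∈ U.components ∧ J.rhs ∈ T.components

theorem premises_spec_of_not_mu (G : List (SType × SType)) {T U : SType} (hT : ∀ S, T ≠ .mu S)
    (hU : ∀ S, U ≠ .mu S) {Z : ℕ} (hTZ : T.size ≤ Z) (hUZ : U.size ≤ Z) :
    (premises G T U).ops ≤ 2 + Z * (2 + Z) ∧
    ∀ Js, (premises G T U).val = some Js → Js.length ≤ Z ∧
      ∀ J ∈ Js, IsComponentPremise G T U J := by
  have key : ∀ a b : ℕ, a ≤ Z → b ≤ Z → a * (2 + b) ≤ Z * (2 + Z) := fun a b ha hb => by gcongr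
  have hZ : Z ≤ Z * (2 + Z) := Nat.le_mul_of_pos_right _ (by omega)
  rcases T with _ | ⟨Ts, S⟩ | ⟨Ts, S⟩ | Bs | Bs | S | i
  case mu => exact absurd rfl (hT S)
  all_goals
    rcases U with _ | ⟨Us, S'⟩ | ⟨Us, S'⟩ | Cs | Cs | S' | j
    case mu => exact absurd rfl (hU S')
    -- Different constructors, variables, and `end ≤ end`: there are no premises to describe.
    all_goals try exact ⟨by simp [premises]; omega, by simp [premises]⟩
  all_goals simp only [SType.size] at hTZ hUZ
  · obtain ⟨-, h2, h3⟩ := payloadPremises_spec G [⟨G, S, S'⟩] Ts Us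
    simp only [premises, Timed.ops_bind, Timed.val_bind, Timed.ops_tick]
    refine ⟨by omega, fun Js hJs => ⟨?_, fun J hJ => ?_⟩⟩
    · have := (h3 Js hJs).1
      have := S.size_pos
      simp at *; omega
    · rcases (h3 Js hJs).2 J hJ with h | h
      · exact ⟨h.1, .inl ⟨List.mem_cons_of_mem _ h.2.1, List.mem_cons_of_mem _ h.2.2⟩⟩
      · obtain rfl := List.mem_singleton.1 h
        exact ⟨rfl, .inl ⟨List.mem_cons_self, List.mem_cons_self⟩⟩
  -- Output is contravariant in the payload, hence the exchanged lists; the continuation stays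
  -- covariant.
  · obtain ⟨-, h2, h3⟩ := payloadPremises_spec G [⟨G, S, S'⟩] Us Ts
    simp only [premises, Timed.ops_bind, Timed.val_bind, Timed.ops_tick]
    refine ⟨by omega, fun Js hJs => ⟨?_, fun J hJ => ?_⟩⟩
    · have := (h3 Js hJs).1
      have := S.size_pos
      simp at *; omega
    · rcases (h3 Js hJs).2 J hJ with h | h
      · exact ⟨h.1, .inr ⟨List.mem_cons_of_mem _ h.2.1, List.mem_cons_of_mem _ h.2.2⟩⟩
      · obtain rfl := List.mem_singleton.1 h
        exact ⟨rfl, .inl ⟨List.mem_cons_self, List.mem_cons_self⟩⟩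
  · obtain ⟨-, h2, h3⟩ := selectPremises_spec G Bs Cs
    have := key Cs.size Bs.size (by omega) (by omega)
    simp only [premises, Timed.ops_bind, Timed.val_bind, Timed.ops_tick]
    refine ⟨by omega, fun Js hJs => ⟨?_, fun J hJ => ?_⟩⟩
    · have := (h3 Js hJs).1
      omega
    · have h := (h3 Js hJs).2 J hJ
      exact ⟨h.1, .inl h.2⟩
  · obtain ⟨-, h2, h3⟩ := branchPremises_spec G Cs Bs
    have := key Bs.size Cs.size (by omega) (by omega)
    simp only [premises, Timed.ops_bind, Timed.val_bind, Timed.ops_tick]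
    refine ⟨by omega, fun Js hJs => ⟨?_, fun J hJ => ?_⟩⟩
    · have := (h3 Js hJs).1
      omega
    · have h := (h3 Js hJs).2 J hJ
      exact ⟨h.1, .inl h.2⟩

/-- The final alternative drives termination: a `μ` rule enlarges the context but may enlarge the
types, whereas a structural rule passes to proper components in the same context. -/
theorem UnfoldClosed.premises_spec {W : List SType} {Z : ℕ} (hW : UnfoldClosed W Z)
    (G : List (SType × SType)) {T U : SType} (hT : T ∈ W) (hU : U ∈ W) :
    (premises G T U).ops ≤ 2 + Z * (2 + 3 * Z) ∧
    ∀ Js, (premises G T U).val = some Js → Js.length ≤ Z ∧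
      ∀ J ∈ Js, J.lhs ∈ W ∧ J.rhs ∈ W ∧
        (J.ctx = (T, U) :: G ∨ J.ctx = G ∧ J.lhs.size + J.rhs.size < T.size + U.size) := by
  have hZ : 1 ≤ Z := T.size_pos.trans_le (hW.size_le T hT)
  have hle : Z * (3 * Z) ≤ Z * (2 + 3 * Z) := by gcongr; omega
  by_cases hT' : ∃ S, T = .mu S
  · obtain ⟨S, rfl⟩ := hT'
    have h := hW.unfold hT
    rw [premises_mu_left]
    refine ⟨by simp; omega, ?_⟩
    simpa [hU, hZ] using h.1
  by_cases hU' : ∃ S, U = .mu S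
  · obtain ⟨S, rfl⟩ := hU'
    have h := hW.unfold hU
    rw [premises_mu_right G (by simpa using hT')]
    refine ⟨by simp; omega, ?_⟩
    simpa [hT, hZ] using h.1
  have h := premises_spec_of_not_mu G (by simpa using hT') (by simpa using hU')
    (hW.size_le T hT) (hW.size_le U hU)
  refine ⟨h.1.trans (by gcongr; omega), fun Js hJs => ⟨(h.2 Js hJs).1, fun J hJ => ?_⟩⟩
  obtain ⟨hctx, ⟨h1, h2⟩ | ⟨h1, h2⟩⟩ := (h.2 Js hJs).2 J hJ
  · have := SType.size_lt_of_mem_components h1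
    have := SType.size_lt_of_mem_components h2
    exact ⟨hW.components _ hT _ h1, hW.components _ hU _ h2, .inr ⟨hctx, by omega⟩⟩
  · have := SType.size_lt_of_mem_components h1
    have := SType.size_lt_of_mem_components h2
    exact ⟨hW.components _ hU _ h1, hW.components _ hT _ h2, .inr ⟨hctx, by omega⟩⟩

/-! ## The memo table and the cost of a call -/

/-- A judgement over a family `W` of types, with a context free of repetitions. -/
structure Judgement.Over (W : List SType) (J : Judgement) : Prop where
  lhs : J.lhs ∈ W
  rhs : J.rhs ∈ W
  ctx : ∀ P ∈ J.ctx, P.1 ∈ W ∧ P.2 ∈ W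
  nodup : J.ctx.Nodup

/-- A context without repetitions is no longer than the list of all pairs from `W`. -/
theorem Judgement.Over.length_ctx_le {W : List SType} {J : Judgement} (h : J.Over W) :
    J.ctx.length ≤ W.length * W.length := by
  have hsub : J.ctx ⊆ W.product W := fun P hP => List.pair_mem_product.2 (h.ctx P hP)
  exact (List.subperm_of_subset h.nodup hsub).length_le.trans_eq (List.length_product W W)

theorem Judgement.Over.bounded {W : List SType} {Z : ℕ} (hW : UnfoldClosed W Z) {J : Judgement}
    (h : J.Over W) : J.Bounded Z (W.length * W.length) where
  lhs := hW.size_le _ h.lhs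
  rhs := hW.size_le _ h.rhs
  ctx P hP := ⟨hW.size_le _ (h.ctx P hP).1, hW.size_le _ (h.ctx P hP).2⟩
  length := h.length_ctx_le

/-- A memo table: pairwise inequivalent judgements over `W`. -/
structure IsTable (W : List SType) (A : List Judgement) : Prop where
  forall_over : ∀ J ∈ A, J.Over W
  pairwise : A.Pairwise fun J K => ¬ J.Equiv K

/-- The number of judgements over a family of `w` types, up to equivalence. -/
def tableBound (w : ℕ) : ℕ := w * w * 2 ^ (w * w)

open Classical in
-- Forgetting the order of the context sends inequivalent judgements to distinct triples of two
-- types and a set of pairs, and these triples are counted.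
theorem IsTable.length_le {W : List SType} {A : List Judgement} (h : IsTable W A) :
    A.length ≤ tableBound W.length := by
  let f : Judgement → SType × SType × Finset (SType × SType) :=
    fun J => (J.lhs, J.rhs, J.ctx.toFinset)
  have hf : ∀ {J K : Judgement}, f J = f K → J.Equiv K := fun {J K} hJK => by
    simp only [f, Prod.mk.injEq] at hJK
    obtain ⟨h1, h2, h3⟩ := hJK
    refine ⟨h1, h2, fun P hP => ?_, fun P hP => ?_⟩
    · rwa [← List.mem_toFinset, ← h3, List.mem_toFinset]
    · rwa [← List.mem_toFinset, h3, List.mem_toFinset]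
  have hnd : (A.map f).Nodup :=
    List.pairwise_map.2 (h.pairwise.imp fun hJK hfJK => hJK (hf hfJK))
  let V := W.toFinset
  have hsub : A.map f ⊆ (V ×ˢ V ×ˢ (V ×ˢ V).powerset).toList := by
    intro x hx
    obtain ⟨J, hJ, rfl⟩ := List.mem_map.1 hx
    have hJ := h.forall_over J hJ
    simp only [f, V, Finset.mem_toList, Finset.mem_product, List.mem_toFinset,
      Finset.mem_powerset]
    refine ⟨hJ.lhs, hJ.rhs, fun P hP => ?_⟩
    simpa using hJ.ctx P (List.mem_toFinset.1 hP)
  have hlen := (List.subperm_of_subset hnd hsub).length_le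
  have hV : V.card ≤ W.length := W.toFinset_card_le
  simp only [List.length_map, Finset.length_toList, Finset.card_product,
    Finset.card_powerset] at hlen
  refine hlen.trans ?_
  rw [← mul_assoc, tableBound]
  gcongr
  norm_num

theorem IsTable.cons {W : List SType} {A : List Judgement} {J : Judgement} (hA : IsTable W A)
    (hJ : J.Over W) (h : ¬ ∃ K ∈ A, J.Equiv K) : IsTable W (J :: A) where
  forall_over := by simpa using ⟨hJ, hA.forall_over⟩
  pairwise := List.pairwise_cons.2 ⟨fun K hK hJK => h ⟨K, hK, hJK⟩, hA.pairwise⟩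

/-- A bound on the number of elementary steps that are charged to one call, for types of size at
most `Z`, contexts of length at most `L` and tables of length at most `N`. -/
def callCost (Z L N : ℕ) : ℕ :=
  5 + N * (4 + 6 * Z + 2 * (L * (2 + L * (6 * Z)))) + L * (6 * Z) + (Z * (2 + 3 * Z) + Z)

/-- A measure that decreases from a judgement to its premises. -/
def Judgement.height (Z L : ℕ) (J : Judgement) : ℕ :=
  (L - J.ctx.length) * (2 * Z + 1) + (J.lhs.size + J.rhs.size)

theorem Judgement.Over.premise {W : List SType} {Z : ℕ} (hW : UnfoldClosed W Z) {J K : Judgement}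
    (hJ : J.Over W) (hmem : (J.lhs, J.rhs) ∉ J.ctx) {Js : List Judgement}
    (hJs : (premises J.ctx J.lhs J.rhs).val = some Js) (hK : K ∈ Js) :
    K.Over W ∧ K.height Z (W.length * W.length) < J.height Z (W.length * W.length) := by
  obtain ⟨h1, h2, h3⟩ := ((hW.premises_spec J.ctx hJ.lhs hJ.rhs).2 Js hJs).2 K hK
  rcases h3 with h3 | ⟨h3, h4⟩
  · have hover : K.Over W := by
      refine ⟨h1, h2, ?_, ?_⟩
      · rw [h3]
        intro P hP
        rcases List.mem_cons.1 hP with rfl | hP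
        · exact ⟨hJ.lhs, hJ.rhs⟩
        · exact hJ.ctx P hP
      · rw [h3]
        -- The rule for assumptions has priority, so a pair that a `μ` rule adds is new to the
        -- context.
        exact List.nodup_cons.2 ⟨hmem, hJ.nodup⟩
    refine ⟨hover, ?_⟩
    have hlen := hover.length_ctx_le
    have hl := hW.size_le _ h1
    have hr := hW.size_le _ h2
    have hJl := J.lhs.size_pos
    simp only [Judgement.height, h3, List.length_cons] at hlen ⊢
    -- The longer context still has length at most L, so the subtraction is genuine and its first
    -- summand drops by 2 * Z + 1, more than the at most 2 * Z of the new types.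
    obtain ⟨e, he⟩ := Nat.exists_eq_add_of_le hlen
    rw [he, show J.ctx.length + 1 + e - (J.ctx.length + 1) = e by omega,
      show J.ctx.length + 1 + e - J.ctx.length = e + 1 by omega, add_mul]
    omega
  · refine ⟨⟨h1, h2, h3 ▸ hJ.ctx, h3 ▸ hJ.nodup⟩, ?_⟩
    simp only [Judgement.height, h3]
    omega

/-- The outcome `R` of a computation that starts with the table `A` and makes `k` calls directly:
it does not exceed the allowed depth, at most `k + Z * s` calls are made, where `s` is the number
of judgements added to the table, and the number of other steps is at most `e + X * calls`. -/
def Timed.Controlled (W : List SType) (Z X k e : ℕ) (A : List Judgement) (R : Timed Outcome) :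
    Prop :=
  R.val ≠ .depthExceeded ∧ R.ops ≤ e + X * R.calls ∧
    ∃ A', IsTable W A' ∧ (∀ B, R.val = .ok B → B = A') ∧
      R.calls + Z * A.length ≤ k + Z * A'.length

/-- The quantity calls - Z * (table length) is additive along the sequence of calls, so each
judgement of `Js` contributes 1 to it. The steps of `checkAll` itself, one per judgement and a last
one, are left to the caller. -/
theorem checkAll_controlled {W : List SType} {Z X : ℕ}
    {f : List Judgement → Judgement → Timed Outcome} (Js : List Judgement)
    (hf : ∀ J ∈ Js, ∀ A, IsTable W A → (f A J).Controlled W Z X 1 0 A) {A : List Judgement}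
    (hA : IsTable W A) :
    (checkAll f A Js).Controlled W Z X Js.length (Js.length + 1) A := by
  induction Js generalizing A with
  | nil => exact ⟨by simp [checkAll], by simp [checkAll], A, hA, by simp [checkAll]⟩
  | cons J Js ih =>
    obtain ⟨h1, h2, A', h3, h4, h5⟩ := hf J (by simp) A hA
    simp only [Timed.Controlled, checkAll, Timed.val_bind, Timed.calls_bind, Timed.ops_bind,
      Timed.calls_tick, Timed.ops_tick, List.length_cons]
    split
    · rename_i A'' hA''
      obtain rfl := h4 _ hA''
      obtain ⟨k1, k2, B, k3, k4, k5⟩ := ih (fun J hJ => hf J (by simp [hJ])) h3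
      refine ⟨k1, by rw [mul_add, mul_add]; omega, B, k3, k4, by omega⟩
    -- A failure returns no table; `A'` is then the table reached when the computation stopped, and
    -- still witnesses the bound on the calls.
    · refine ⟨by simp, by simp; omega, A', h3, by simp, by simp; omega⟩
    · rename_i h
      exact absurd h h1

/-- Amortization: if the judgement is already in the table, only the call itself is charged.
Otherwise the table grows by one, and this releases Z units, enough for the calls on all premises.
The elementary steps of the call, including those of `checkAll` on its premises, are covered by
`callCost`. -/
theorem memoSubtype_controlled {W : List SType} {Z : ℕ} (hW : UnfoldClosed W Z) (d : ℕ)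
    {A : List Judgement} (hA : IsTable W A) {J : Judgement} (hJ : J.Over W)
    (hd : J.height Z (W.length * W.length) < d) :
    (memoSubtype d A J).Controlled W Z
      (callCost Z (W.length * W.length) (tableBound W.length)) 1 0 A := by
  induction d generalizing A J with
  | zero => omega
  | succ d ih =>
    set L := W.length * W.length with hL
    set N := tableBound W.length with hN
    have hZ : 1 ≤ Z := J.lhs.size_pos.trans_le (hW.size_le _ hJ.lhs)
    have hb := hJ.bounded hW
    have c1 : (memJudgement J A).ops ≤ 1 + N * (4 + 6 * Z + 2 * (L * (2 + L * (6 * Z)))) :=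
      (memJudgement_ops hb fun K hK => (hA.forall_over K hK).bounded hW).trans (by
        have := hA.length_le
        gcongr)
    have c2 : (memPair J.lhs J.rhs J.ctx).ops ≤ 1 + L * (6 * Z) :=
      (memPair_ops J.lhs J.rhs J.ctx).trans (by
        have := hb.length
        have h1 := hb.lhs
        have h2 := hb.rhs
        have : 3 * (J.lhs.size + J.rhs.size) ≤ 6 * Z := by omega
        gcongr)
    obtain ⟨c3, hp⟩ := hW.premises_spec J.ctx hJ.lhs hJ.rhs
    have v1 := memJudgement_val J A
    have v2 := memPair_val J.lhs J.rhs J.ctx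
    simp only [Timed.Controlled, memoSubtype, Timed.val_bind, Timed.calls_bind, Timed.ops_bind,
      Timed.calls_tickCall, Timed.ops_tickCall, memJudgement_calls]
    split
    · refine ⟨by simp, by simp [callCost]; omega, A, hA, by simp, by simp⟩
    · rename_i hmem
      have hA' := hA.cons hJ (mt v1.2 hmem)
      simp only [Timed.val_bind, Timed.calls_bind, Timed.ops_bind, memPair_calls]
      split
      · exact ⟨by simp, by simp [callCost]; omega, J :: A, hA', by simp, by simp [mul_add]⟩
      · rename_i hctx
        simp only [Timed.val_bind, Timed.calls_bind, Timed.ops_bind, premises_calls]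
        split
        · rename_i Js hJs
          have hlen := (hp Js hJs).1
          obtain ⟨k1, k2, B, k3, k4, k5⟩ := checkAll_controlled (f := memoSubtype d) Js
            (fun K hK A hA => by
              have hK := hJ.premise hW (mt v2.2 hctx) hJs hK
              exact ih hA hK.1 (by rw [← hL] at hK; omega)) hA'
          simp only [List.length_cons, mul_add, mul_one] at k5
          refine ⟨k1, ?_, B, k3, k4, by omega⟩
          simp only [mul_add, mul_one, zero_add]
          rw [show callCost Z L N = 5 + N * (4 + 6 * Z + 2 * (L * (2 + L * (6 * Z)))) +
            L * (6 * Z) + (Z * (2 + 3 * Z) + Z) from rfl] at k2 ⊢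
          generalize N * (4 + 6 * Z + 2 * (L * (2 + L * (6 * Z)))) = Y at *
          omega
        · refine ⟨by simp, by simp [callCost]; omega, J :: A, hA', by simp, by simp [mul_add]⟩

theorem exists_memoRunsIn {W : List SType} {Z : ℕ} (hW : UnfoldClosed W Z) {T U : SType}
    (hT : T ∈ W) (hU : U ∈ W) :
    ∃ calls ops : ℕ, MemoRunsIn T U calls ops ∧ calls + ops ≤
      (1 + Z * tableBound W.length) *
        (1 + callCost Z (W.length * W.length) (tableBound W.length)) := by
  have hJ : (Judgement.mk [] T U).Over W := ⟨hT, hU, by simp, by simp⟩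
  obtain ⟨h1, h2, A, h3, -, h5⟩ := memoSubtype_controlled hW _ (A := [])
    ⟨by simp, by simp⟩ hJ (Nat.lt_succ_self _)
  set R := memoSubtype _ [] ⟨[], T, U⟩ with hR
  refine ⟨R.calls, R.ops, ⟨_, R.val, h1, rfl⟩, ?_⟩
  have hc : R.calls ≤ 1 + Z * tableBound W.length :=
    calc R.calls ≤ 1 + Z * A.length := by simpa using h5
      _ ≤ _ := by have := h3.length_le; gcongr
  calc R.calls + R.ops
      ≤ R.calls * (1 + callCost Z (W.length * W.length) (tableBound W.length)) := by
        rw [mul_add, mul_one, mul_comm R.calls]; omega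
    _ ≤ _ := by gcongr

/-! ## Successful runs -/

/-- The outcome of a successful computation that starts with the table `A`: the new table `A'`
consists of at most `c` new judgements and the old ones, and every new judgement either holds by
assumption or has premises all of which are in the new table. -/
def Saturates (c : ℕ) (A A' : List Judgement) : Prop :=
  ∃ B, A' = B ++ A ∧ B.length ≤ c ∧ ∀ K ∈ B, (K.lhs, K.rhs) ∈ K.ctx ∨
    ∃ Js, (premises K.ctx K.lhs K.rhs).val = some Js ∧ ∀ J ∈ Js, ∃ J' ∈ A', J.Equiv J'

theorem Saturates.trans {c c' : ℕ} {A A' A'' : List Judgement} (h : Saturates c A A')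
    (h' : Saturates c' A' A'') : Saturates (c + c') A A'' := by
  obtain ⟨B, rfl, hB, hK⟩ := h
  obtain ⟨B', rfl, hB', hK'⟩ := h'
  refine ⟨B' ++ B, by simp, by simp; omega, fun K hK0 => ?_⟩
  rcases List.mem_append.1 hK0 with hK0 | hK0
  · exact hK' K hK0
  · refine (hK K hK0).imp_right fun ⟨Js, h1, h2⟩ => ⟨Js, h1, fun J hJ => ?_⟩
    obtain ⟨J', hJ', hJJ'⟩ := h2 J hJ
    exact ⟨J', List.mem_append_right _ hJ', hJJ'⟩

theorem Saturates.subset {c : ℕ} {A A' : List Judgement} (h : Saturates c A A') : A ⊆ A' := by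
  obtain ⟨B, rfl, -⟩ := h
  exact List.subset_append_right _ _

theorem checkAll_saturates {f : List Judgement → Judgement → Timed Outcome} (Js : List Judgement)
    (hf : ∀ A J A', (f A J).val = .ok A' →
      Saturates (f A J).calls A A' ∧ ∃ J' ∈ A', J.Equiv J') {A A' : List Judgement}
    (h : (checkAll f A Js).val = .ok A') :
    Saturates (checkAll f A Js).calls A A' ∧ ∀ J ∈ Js, ∃ J' ∈ A', J.Equiv J' := by
  induction Js generalizing A with
  | nil =>
    obtain rfl : A = A' := by simpa [checkAll] using h
    exact ⟨⟨[], by simp⟩, by simp⟩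
  | cons J Js ih =>
    simp only [checkAll, Timed.val_bind, Timed.calls_bind, Timed.calls_tick] at h ⊢
    split at h
    · rename_i B hB
      obtain ⟨h1, J', h2, h3⟩ := hf A J B hB
      obtain ⟨h4, h5⟩ := ih h
      refine ⟨by simpa using h1.trans h4, fun K hK => ?_⟩
      rcases List.mem_cons.1 hK with rfl | hK
      · exact ⟨J', h4.subset h2, h3⟩
      · exact h5 K hK
    · simp at h
    · simp at h

/-- A judgement enters the table before its premises are checked, so its premises are guaranteed
only in the final table. A successful run completes every check it has begun, and a call adds at
most one judgement directly. -/
theorem memoSubtype_saturates (d : ℕ) {A A' : List Judgement} {J : Judgement}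
    (h : (memoSubtype d A J).val = .ok A') :
    Saturates (memoSubtype d A J).calls A A' ∧ ∃ J' ∈ A', J.Equiv J' := by
  induction d generalizing A A' J with
  | zero => simp [memoSubtype] at h
  | succ d ih =>
    have v1 := memJudgement_val J A
    have v2 := memPair_val J.lhs J.rhs J.ctx
    simp only [memoSubtype, Timed.val_bind, Timed.calls_bind, Timed.calls_tickCall,
      memJudgement_calls] at h ⊢
    split at h
    · rename_i hmem
      obtain rfl : A = A' := by simpa using h
      exact ⟨⟨[], by simp⟩, v1.1 hmem⟩
    · rename_i hmem
      simp only [if_neg hmem, Timed.val_bind, Timed.calls_bind, memPair_calls] at h ⊢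
      split at h
      · rename_i hctx
        obtain rfl : J :: A = A' := by simpa using h
        refine ⟨⟨[J], by simp, by simp, ?_⟩, J, by simp, .refl J⟩
        simpa using .inl (v2.1 hctx)
      · rename_i hctx
        simp only [if_neg hctx, Timed.val_bind, Timed.calls_bind, premises_calls] at h ⊢
        split at h
        · rename_i Js hJs
          obtain ⟨⟨B, rfl, h1, h2⟩, h3⟩ :=
            checkAll_saturates (f := memoSubtype d) Js (fun A J A' => ih) h
          refine ⟨⟨B ++ [J], by simp, by simp; omega, fun K hK => ?_⟩, J, by simp, .refl J⟩
          rcases List.mem_append.1 hK with hK | hK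
          · exact h2 K hK
          · obtain rfl := List.mem_singleton.1 hK
            exact .inr ⟨Js, hJs, h3⟩
        · simp at h

theorem checkAll_ne_fail {f : List Judgement → Judgement → Timed Outcome} {Js : List Judgement}
    (hf : ∀ J ∈ Js, ∀ A, (f A J).val ≠ .fail) (A : List Judgement) :
    (checkAll f A Js).val ≠ .fail := by
  induction Js generalizing A with
  | nil => simp [checkAll]
  | cons J Js ih =>
    simp only [checkAll, Timed.val_bind]
    split
    · exact ih (fun J hJ => hf J (by simp [hJ])) _
    · rename_i h
      exact absurd h (hf J (by simp) A)
    · simp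

/-- A run fails only at a judgement to which no rule applies; a relation `Q` that always admits a
rule and is inherited by premises excludes this. -/
theorem memoSubtype_ne_fail {Q : SType → SType → Prop}
    (hQ : ∀ G T U, Q T U → ∃ Js, (premises G T U).val = some Js ∧ ∀ J ∈ Js, Q J.lhs J.rhs)
    (d : ℕ) (A : List Judgement) {J : Judgement} (hJ : Q J.lhs J.rhs) :
    (memoSubtype d A J).val ≠ .fail := by
  induction d generalizing A J with
  | zero => simp [memoSubtype]
  | succ d ih =>
    simp only [memoSubtype, Timed.val_bind]
    split
    · simp
    · simp only [Timed.val_bind]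
      split
      · simp
      · obtain ⟨Js, h1, h2⟩ := hQ J.ctx _ _ hJ
        simp only [Timed.val_bind, h1]
        exact checkAll_ne_fail (fun K hK A => ih A (h2 K hK)) _

/-! ## Closed types and simultaneous substitution -/

mutual
theorem SType.ClosedBelow.mono : ∀ {T : SType} {j k : ℕ}, T.ClosedBelow j → j ≤ k → T.ClosedBelow k
  | .done, j, k, h, hjk => by simp [SType.ClosedBelow]
  | .inp Ts S, j, k, h, hjk => by
    simp only [SType.ClosedBelow] at h ⊢
    exact ⟨STypes.ClosedBelow.mono h.1 hjk, SType.ClosedBelow.mono h.2 hjk⟩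
  | .out Ts S, j, k, h, hjk => by
    simp only [SType.ClosedBelow] at h ⊢
    exact ⟨STypes.ClosedBelow.mono h.1 hjk, SType.ClosedBelow.mono h.2 hjk⟩
  | .sel Bs, j, k, h, hjk => by
    simp only [SType.ClosedBelow] at h ⊢
    exact SBranches.ClosedBelow.mono h hjk
  | .bra Bs, j, k, h, hjk => by
    simp only [SType.ClosedBelow] at h ⊢
    exact SBranches.ClosedBelow.mono h hjk
  | .mu S, j, k, h, hjk => by
    simp only [SType.ClosedBelow] at h ⊢
    exact SType.ClosedBelow.mono h (by omega)
  | .var i, j, k, h, hjk => by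
    simp only [SType.ClosedBelow] at h ⊢
    omega
theorem STypes.ClosedBelow.mono :
    ∀ {Ts : STypes} {j k : ℕ}, Ts.ClosedBelow j → j ≤ k → Ts.ClosedBelow k
  | .nil, j, k, h, hjk => by simp [STypes.ClosedBelow]
  | .cons T Ts, j, k, h, hjk => by
    simp only [STypes.ClosedBelow] at h ⊢
    exact ⟨SType.ClosedBelow.mono h.1 hjk, STypes.ClosedBelow.mono h.2 hjk⟩
theorem SBranches.ClosedBelow.mono :
    ∀ {Bs : SBranches} {j k : ℕ}, Bs.ClosedBelow j → j ≤ k → Bs.ClosedBelow k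
  | .nil, j, k, h, hjk => by simp [SBranches.ClosedBelow]
  | .cons l T Bs, j, k, h, hjk => by
    simp only [SBranches.ClosedBelow] at h ⊢
    exact ⟨SType.ClosedBelow.mono h.1 hjk, SBranches.ClosedBelow.mono h.2 hjk⟩
end

mutual
theorem SType.ClosedBelow.subst_eq (V : SType) :
    ∀ {T : SType} {k : ℕ}, T.ClosedBelow k → (SType.subst V k T).val = T
  | .done, k, h => by simp [SType.subst]
  | .inp Ts S, k, h => by
    simp only [SType.ClosedBelow] at h
    simp [SType.subst, STypes.ClosedBelow.subst_eq V h.1, SType.ClosedBelow.subst_eq V h.2]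
  | .out Ts S, k, h => by
    simp only [SType.ClosedBelow] at h
    simp [SType.subst, STypes.ClosedBelow.subst_eq V h.1, SType.ClosedBelow.subst_eq V h.2]
  | .sel Bs, k, h => by
    simp only [SType.ClosedBelow] at h
    simp [SType.subst, SBranches.ClosedBelow.subst_eq V h]
  | .bra Bs, k, h => by
    simp only [SType.ClosedBelow] at h
    simp [SType.subst, SBranches.ClosedBelow.subst_eq V h]
  | .mu S, k, h => by
    simp only [SType.ClosedBelow] at h
    simp [SType.subst, SType.ClosedBelow.subst_eq V h]
  | .var i, k, h => by
    simp only [SType.ClosedBelow] at h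
    simp [SType.subst, h.ne]
theorem STypes.ClosedBelow.subst_eq (V : SType) :
    ∀ {Ts : STypes} {k : ℕ}, Ts.ClosedBelow k → (STypes.subst V k Ts).val = Ts
  | .nil, k, h => by simp [STypes.subst]
  | .cons T Ts, k, h => by
    simp only [STypes.ClosedBelow] at h
    simp [STypes.subst, SType.ClosedBelow.subst_eq V h.1, STypes.ClosedBelow.subst_eq V h.2]
theorem SBranches.ClosedBelow.subst_eq (V : SType) :
    ∀ {Bs : SBranches} {k : ℕ}, Bs.ClosedBelow k → (SBranches.subst V k Bs).val = Bs
  | .nil, k, h => by simp [SBranches.subst]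
  | .cons l T Bs, k, h => by
    simp only [SBranches.ClosedBelow] at h
    simp [SBranches.subst, SType.ClosedBelow.subst_eq V h.1, SBranches.ClosedBelow.subst_eq V h.2]
end

mutual
/-- Simultaneous substitution of the closed types `σ` for the variables from index `k` on; further
variables are replaced by `end`. -/
def SType.inst (σ : List SType) : ℕ → SType → SType
  | _, .done => .done
  | k, .inp Ts S => .inp (Ts.inst σ k) (S.inst σ k)
  | k, .out Ts S => .out (Ts.inst σ k) (S.inst σ k)
  | k, .sel Bs => .sel (Bs.inst σ k)
  | k, .bra Bs => .bra (Bs.inst σ k)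
  | k, .mu S => .mu (S.inst σ (k + 1))
  | k, .var i => if i < k then .var i else (σ[i - k]?).getD .done
/-- Simultaneous substitution in every member. -/
def STypes.inst (σ : List SType) : ℕ → STypes → STypes
  | _, .nil => .nil
  | k, .cons T Ts => .cons (T.inst σ k) (Ts.inst σ k)
/-- Simultaneous substitution in every member. -/
def SBranches.inst (σ : List SType) : ℕ → SBranches → SBranches
  | _, .nil => .nil
  | k, .cons l T Bs => .cons l (T.inst σ k) (Bs.inst σ k)
end

theorem getD_done_property {P : SType → Prop} {σ : List SType} (hσ : ∀ X ∈ σ, P X)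
    (h : P .done) (i : ℕ) : P ((σ[i]?).getD .done) := by
  cases hi : σ[i]? with
  | none => simpa using h
  | some X => simpa using hσ X (List.mem_of_getElem? hi)

mutual
-- No condition on `T` is needed because variables beyond `σ` become `end`.
theorem SType.inst_closedBelow {σ : List SType} (hσ : ∀ X ∈ σ, X.ClosedBelow 0) :
    ∀ (T : SType) (k : ℕ), (T.inst σ k).ClosedBelow k
  | .done, k => by simp [SType.inst, SType.ClosedBelow]
  | .inp Ts S, k => by
    simpa [SType.inst, SType.ClosedBelow] using
      ⟨STypes.inst_closedBelow hσ Ts k, SType.inst_closedBelow hσ S k⟩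
  | .out Ts S, k => by
    simpa [SType.inst, SType.ClosedBelow] using
      ⟨STypes.inst_closedBelow hσ Ts k, SType.inst_closedBelow hσ S k⟩
  | .sel Bs, k => by
    simpa [SType.inst, SType.ClosedBelow] using SBranches.inst_closedBelow hσ Bs k
  | .bra Bs, k => by
    simpa [SType.inst, SType.ClosedBelow] using SBranches.inst_closedBelow hσ Bs k
  | .mu S, k => by
    simpa [SType.inst, SType.ClosedBelow] using SType.inst_closedBelow hσ S (k + 1)
  | .var i, k => by
    simp only [SType.inst]
    split
    · simpa [SType.ClosedBelow]
    · exact getD_done_property (P := fun X => X.ClosedBelow k)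
        (fun X hX => (hσ X hX).mono (Nat.zero_le k)) (by simp [SType.ClosedBelow]) _
theorem STypes.inst_closedBelow {σ : List SType} (hσ : ∀ X ∈ σ, X.ClosedBelow 0) :
    ∀ (Ts : STypes) (k : ℕ), (Ts.inst σ k).ClosedBelow k
  | .nil, k => by simp [STypes.inst, STypes.ClosedBelow]
  | .cons T Ts, k => by
    simpa [STypes.inst, STypes.ClosedBelow] using
      ⟨SType.inst_closedBelow hσ T k, STypes.inst_closedBelow hσ Ts k⟩
theorem SBranches.inst_closedBelow {σ : List SType} (hσ : ∀ X ∈ σ, X.ClosedBelow 0) :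
    ∀ (Bs : SBranches) (k : ℕ), (Bs.inst σ k).ClosedBelow k
  | .nil, k => by simp [SBranches.inst, SBranches.ClosedBelow]
  | .cons l T Bs, k => by
    simpa [SBranches.inst, SBranches.ClosedBelow] using
      ⟨SType.inst_closedBelow hσ T k, SBranches.inst_closedBelow hσ Bs k⟩
end

mutual
-- Unfolding a recursive type thus extends the environment of its body by one entry. The types in
-- `σ` are closed, so the later substitution leaves them alone.
theorem SType.subst_inst {σ : List SType} (hσ : ∀ X ∈ σ, X.ClosedBelow 0) (V : SType) :
    ∀ (T : SType) (k : ℕ), (SType.subst V k (T.inst σ (k + 1))).val = T.inst (V :: σ) k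
  | .done, k => by simp [SType.inst, SType.subst]
  | .inp Ts S, k => by
    simp [SType.inst, SType.subst, STypes.subst_inst hσ V Ts k, SType.subst_inst hσ V S k]
  | .out Ts S, k => by
    simp [SType.inst, SType.subst, STypes.subst_inst hσ V Ts k, SType.subst_inst hσ V S k]
  | .sel Bs, k => by simp [SType.inst, SType.subst, SBranches.subst_inst hσ V Bs k]
  | .bra Bs, k => by simp [SType.inst, SType.subst, SBranches.subst_inst hσ V Bs k]
  | .mu S, k => by simp [SType.inst, SType.subst, SType.subst_inst hσ V S (k + 1)]
  | .var i, k => by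
    simp only [SType.inst]
    rcases lt_trichotomy i k with h | rfl | h
    · simp [h, h.trans (Nat.lt_succ_self k), SType.subst, h.ne]
    · simp [SType.subst]
    · rw [if_neg (by omega), if_neg (by omega), show i - k = i - (k + 1) + 1 by omega,
        List.getElem?_cons_succ]
      exact (getD_done_property (P := fun X => X.ClosedBelow k)
        (fun X hX => (hσ X hX).mono (Nat.zero_le k)) (by simp [SType.ClosedBelow]) _).subst_eq V
theorem STypes.subst_inst {σ : List SType} (hσ : ∀ X ∈ σ, X.ClosedBelow 0) (V : SType) :
    ∀ (Ts : STypes) (k : ℕ), (STypes.subst V k (Ts.inst σ (k + 1))).val = Ts.inst (V :: σ) k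
  | .nil, k => by simp [STypes.inst, STypes.subst]
  | .cons T Ts, k => by
    simp [STypes.inst, STypes.subst, SType.subst_inst hσ V T k, STypes.subst_inst hσ V Ts k]
theorem SBranches.subst_inst {σ : List SType} (hσ : ∀ X ∈ σ, X.ClosedBelow 0) (V : SType) :
    ∀ (Bs : SBranches) (k : ℕ),
      (SBranches.subst V k (Bs.inst σ (k + 1))).val = Bs.inst (V :: σ) k
  | .nil, k => by simp [SBranches.inst, SBranches.subst]
  | .cons l T Bs, k => by
    simp [SBranches.inst, SBranches.subst, SType.subst_inst hσ V T k,
      SBranches.subst_inst hσ V Bs k]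
end

mutual
theorem SType.ClosedBelow.inst_eq (σ : List SType) :
    ∀ {T : SType} {k : ℕ}, T.ClosedBelow k → T.inst σ k = T
  | .done, k, h => by simp [SType.inst]
  | .inp Ts S, k, h => by
    simp only [SType.ClosedBelow] at h
    simp [SType.inst, STypes.ClosedBelow.inst_eq σ h.1, SType.ClosedBelow.inst_eq σ h.2]
  | .out Ts S, k, h => by
    simp only [SType.ClosedBelow] at h
    simp [SType.inst, STypes.ClosedBelow.inst_eq σ h.1, SType.ClosedBelow.inst_eq σ h.2]
  | .sel Bs, k, h => by
    simp only [SType.ClosedBelow] at h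
    simp [SType.inst, SBranches.ClosedBelow.inst_eq σ h]
  | .bra Bs, k, h => by
    simp only [SType.ClosedBelow] at h
    simp [SType.inst, SBranches.ClosedBelow.inst_eq σ h]
  | .mu S, k, h => by
    simp only [SType.ClosedBelow] at h
    simp [SType.inst, SType.ClosedBelow.inst_eq σ h]
  | .var i, k, h => by
    simp only [SType.ClosedBelow] at h
    simp [SType.inst, h]
theorem STypes.ClosedBelow.inst_eq (σ : List SType) :
    ∀ {Ts : STypes} {k : ℕ}, Ts.ClosedBelow k → Ts.inst σ k = Ts
  | .nil, k, h => by simp [STypes.inst]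
  | .cons T Ts, k, h => by
    simp only [STypes.ClosedBelow] at h
    simp [STypes.inst, SType.ClosedBelow.inst_eq σ h.1, STypes.ClosedBelow.inst_eq σ h.2]
theorem SBranches.ClosedBelow.inst_eq (σ : List SType) :
    ∀ {Bs : SBranches} {k : ℕ}, Bs.ClosedBelow k → Bs.inst σ k = Bs
  | .nil, k, h => by simp [SBranches.inst]
  | .cons l T Bs, k, h => by
    simp only [SBranches.ClosedBelow] at h
    simp [SBranches.inst, SType.ClosedBelow.inst_eq σ h.1, SBranches.ClosedBelow.inst_eq σ h.2]
end

mutual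
theorem SType.inst_size {σ : List SType} {M : ℕ} (hM : 1 ≤ M) (hσ : ∀ X ∈ σ, X.size ≤ M) :
    ∀ (T : SType) (k : ℕ), (T.inst σ k).size ≤ T.size * M
  | .done, k => by simpa [SType.inst, SType.size] using hM
  | .inp Ts S, k => by
    have := STypes.inst_size hM hσ Ts k
    have := SType.inst_size hM hσ S k
    simp only [SType.inst, SType.size, add_mul]; omega
  | .out Ts S, k => by
    have := STypes.inst_size hM hσ Ts k
    have := SType.inst_size hM hσ S k
    simp only [SType.inst, SType.size, add_mul]; omega
  | .sel Bs, k => by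
    have := SBranches.inst_size hM hσ Bs k
    simp only [SType.inst, SType.size, add_mul]; omega
  | .bra Bs, k => by
    have := SBranches.inst_size hM hσ Bs k
    simp only [SType.inst, SType.size, add_mul]; omega
  | .mu S, k => by
    have := SType.inst_size hM hσ S (k + 1)
    simp only [SType.inst, SType.size, add_mul]; omega
  | .var i, k => by
    simp only [SType.inst, SType.size, one_mul]
    split
    · simpa [SType.size] using hM
    · exact getD_done_property (P := fun X => X.size ≤ M) hσ (by simpa [SType.size] using hM) _
theorem STypes.inst_size {σ : List SType} {M : ℕ} (hM : 1 ≤ M) (hσ : ∀ X ∈ σ, X.size ≤ M) :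
    ∀ (Ts : STypes) (k : ℕ), (Ts.inst σ k).size ≤ Ts.size * M
  | .nil, k => by simp [STypes.inst, STypes.size]
  | .cons T Ts, k => by
    have := STypes.inst_size hM hσ Ts k
    have := SType.inst_size hM hσ T k
    simp only [STypes.inst, STypes.size, add_mul]; omega
theorem SBranches.inst_size {σ : List SType} {M : ℕ} (hM : 1 ≤ M) (hσ : ∀ X ∈ σ, X.size ≤ M) :
    ∀ (Bs : SBranches) (k : ℕ), (Bs.inst σ k).size ≤ Bs.size * M
  | .nil, k => by simp [SBranches.inst, SBranches.size]
  | .cons l T Bs, k => by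
    have := SBranches.inst_size hM hσ Bs k
    have := SType.inst_size hM hσ T k
    simp only [SBranches.inst, SBranches.size, add_mul]; omega
end

/-! ## The types reachable by unfolding -/

mutual
/-- The subterms of a type, instantiated by `σ` and by the recursive types that bind their
variables. -/
def SType.reach (σ : List SType) : SType → List SType
  | .done => [.done]
  | .inp Ts S => (SType.inp Ts S).inst σ 0 :: (Ts.reach σ ++ S.reach σ)
  | .out Ts S => (SType.out Ts S).inst σ 0 :: (Ts.reach σ ++ S.reach σ)
  | .sel Bs => (SType.sel Bs).inst σ 0 :: Bs.reach σ
  | .bra Bs => (SType.bra Bs).inst σ 0 :: Bs.reach σ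
  | .mu S => (SType.mu S).inst σ 0 :: S.reach ((SType.mu S).inst σ 0 :: σ)
  | .var i => [(SType.var i).inst σ 0]
/-- The reachable types of all members. -/
def STypes.reach (σ : List SType) : STypes → List SType
  | .nil => []
  | .cons T Ts => T.reach σ ++ Ts.reach σ
/-- The reachable types of all members. -/
def SBranches.reach (σ : List SType) : SBranches → List SType
  | .nil => []
  | .cons _ T Bs => T.reach σ ++ Bs.reach σ
end

mutual
theorem SType.length_reach : ∀ (T : SType) (σ : List SType), (T.reach σ).length = T.size
  | .done, σ => by simp [SType.reach, SType.size]
  | .inp Ts S, σ => by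
    simp [SType.reach, SType.size, STypes.length_reach Ts, SType.length_reach S]
  | .out Ts S, σ => by
    simp [SType.reach, SType.size, STypes.length_reach Ts, SType.length_reach S]
  | .sel Bs, σ => by simp [SType.reach, SType.size, SBranches.length_reach Bs]
  | .bra Bs, σ => by simp [SType.reach, SType.size, SBranches.length_reach Bs]
  | .mu S, σ => by simp [SType.reach, SType.size, SType.length_reach S]
  | .var i, σ => by simp [SType.reach, SType.size]
theorem STypes.length_reach : ∀ (Ts : STypes) (σ : List SType), (Ts.reach σ).length = Ts.size
  | .nil, σ => by simp [STypes.reach, STypes.size]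
  | .cons T Ts, σ => by
    simp [STypes.reach, STypes.size, STypes.length_reach Ts, SType.length_reach T]
theorem SBranches.length_reach :
    ∀ (Bs : SBranches) (σ : List SType), (Bs.reach σ).length = Bs.size
  | .nil, σ => by simp [SBranches.reach, SBranches.size]
  | .cons l T Bs, σ => by
    simp [SBranches.reach, SBranches.size, SBranches.length_reach Bs, SType.length_reach T]
end

theorem SType.inst_mem_reach (σ : List SType) (T : SType) : T.inst σ 0 ∈ T.reach σ := by
  cases T <;> simp [SType.reach, SType.inst]

theorem STypes.inst_toList_subset_reach (σ : List SType) :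
    ∀ Ts : STypes, (Ts.inst σ 0).toList ⊆ Ts.reach σ
  | .nil => by simp [STypes.inst, STypes.toList]
  | .cons T Ts => by
    have := STypes.inst_toList_subset_reach σ Ts
    simp only [STypes.inst, STypes.toList, STypes.reach, List.cons_subset, List.mem_append]
    exact ⟨.inl (T.inst_mem_reach σ), List.subset_append_of_subset_right _ this⟩

theorem SBranches.inst_types_subset_reach (σ : List SType) :
    ∀ Bs : SBranches, (Bs.inst σ 0).types ⊆ Bs.reach σ
  | .nil => by simp [SBranches.inst, SBranches.types]
  | .cons l T Bs => by
    have := SBranches.inst_types_subset_reach σ Bs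
    simp only [SBranches.inst, SBranches.types, SBranches.reach, List.cons_subset, List.mem_append]
    exact ⟨.inl (T.inst_mem_reach σ), List.subset_append_of_subset_right _ this⟩

theorem SType.inst_size_le_pow {N e M : ℕ} {T : SType} {σ : List SType} (hT : T.size ≤ e)
    (he : e ≤ N) (hM : 1 ≤ M) (hσ : ∀ Y ∈ σ, Y.size ≤ M) : (T.inst σ 0).size ≤ N ^ e * M :=
  (SType.inst_size hM hσ T 0).trans (Nat.mul_le_mul_right _
    ((hT.trans he).trans (Nat.le_self_pow (T.size_pos.trans_le hT).ne' N)))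

mutual
-- Instantiation multiplies the bound M on the environment by at most N. Entering a `μ` replaces M
-- by N * M, but uses up one unit of the exponent because the body is smaller.
theorem SType.size_le_of_mem_reach {N : ℕ} {X : SType} : ∀ {T : SType} {σ : List SType}
    {e M : ℕ}, T.size ≤ e → e ≤ N → 1 ≤ M → (∀ Y ∈ σ, Y.size ≤ M) → X ∈ T.reach σ →
      X.size ≤ N ^ e * M
  | .done, σ, e, M, hT, he, hM, hσ, hX => by
    obtain rfl : X = SType.done.inst σ 0 := by simpa [SType.reach, SType.inst] using hX
    exact SType.inst_size_le_pow hT he hM hσ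
  | .inp Ts S, σ, e, M, hT, he, hM, hσ, hX => by
    simp only [SType.reach, List.mem_cons, List.mem_append] at hX
    have h := hT
    rw [SType.size] at h
    rcases hX with rfl | hX | hX
    · exact SType.inst_size_le_pow hT he hM hσ
    · exact STypes.size_le_of_mem_reach (by omega) he hM hσ hX
    · exact SType.size_le_of_mem_reach (by omega) he hM hσ hX
  | .out Ts S, σ, e, M, hT, he, hM, hσ, hX => by
    simp only [SType.reach, List.mem_cons, List.mem_append] at hX
    have h := hT
    rw [SType.size] at h
    rcases hX with rfl | hX | hX
    · exact SType.inst_size_le_pow hT he hM hσ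
    · exact STypes.size_le_of_mem_reach (by omega) he hM hσ hX
    · exact SType.size_le_of_mem_reach (by omega) he hM hσ hX
  | .sel Bs, σ, e, M, hT, he, hM, hσ, hX => by
    simp only [SType.reach, List.mem_cons] at hX
    have h := hT
    rw [SType.size] at h
    rcases hX with rfl | hX
    · exact SType.inst_size_le_pow hT he hM hσ
    · exact SBranches.size_le_of_mem_reach (by omega) he hM hσ hX
  | .bra Bs, σ, e, M, hT, he, hM, hσ, hX => by
    simp only [SType.reach, List.mem_cons] at hX
    have h := hT
    rw [SType.size] at h
    rcases hX with rfl | hX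
    · exact SType.inst_size_le_pow hT he hM hσ
    · exact SBranches.size_le_of_mem_reach (by omega) he hM hσ hX
  | .mu S, σ, e, M, hT, he, hM, hσ, hX => by
    simp only [SType.reach, List.mem_cons] at hX
    have h := hT
    rw [SType.size] at h
    rcases hX with rfl | hX
    · exact SType.inst_size_le_pow hT he hM hσ
    · obtain ⟨e, rfl⟩ : ∃ e', e = e' + 1 := ⟨e - 1, by omega⟩
      have hN : 1 ≤ N := by omega
      rw [pow_succ, mul_assoc]
      refine SType.size_le_of_mem_reach (by omega) (by omega) (Nat.mul_pos hN hM) ?_ hX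
      intro Y hY
      rcases List.mem_cons.1 hY with rfl | hY
      · exact (SType.inst_size hM hσ _ 0).trans (Nat.mul_le_mul_right _ (hT.trans he))
      · exact (hσ Y hY).trans (Nat.le_mul_of_pos_left _ hN)
  | .var i, σ, e, M, hT, he, hM, hσ, hX => by
    obtain rfl : X = (SType.var i).inst σ 0 := by simpa [SType.reach] using hX
    exact SType.inst_size_le_pow hT he hM hσ
theorem STypes.size_le_of_mem_reach {N : ℕ} {X : SType} : ∀ {Ts : STypes} {σ : List SType}
    {e M : ℕ}, Ts.size ≤ e → e ≤ N → 1 ≤ M → (∀ Y ∈ σ, Y.size ≤ M) → X ∈ Ts.reach σ →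
      X.size ≤ N ^ e * M
  | .nil, σ, e, M, hT, he, hM, hσ, hX => by simp [STypes.reach] at hX
  | .cons T Ts, σ, e, M, hT, he, hM, hσ, hX => by
    rw [STypes.size] at hT
    rcases List.mem_append.1 hX with hX | hX
    · exact SType.size_le_of_mem_reach (by omega) he hM hσ hX
    · exact STypes.size_le_of_mem_reach (by omega) he hM hσ hX
theorem SBranches.size_le_of_mem_reach {N : ℕ} {X : SType} : ∀ {Bs : SBranches} {σ : List SType}
    {e M : ℕ}, Bs.size ≤ e → e ≤ N → 1 ≤ M → (∀ Y ∈ σ, Y.size ≤ M) → X ∈ Bs.reach σ →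
      X.size ≤ N ^ e * M
  | .nil, σ, e, M, hT, he, hM, hσ, hX => by simp [SBranches.reach] at hX
  | .cons l T Bs, σ, e, M, hT, he, hM, hσ, hX => by
    rw [SBranches.size] at hT
    rcases List.mem_append.1 hX with hX | hX
    · exact SType.size_le_of_mem_reach (by omega) he hM hσ hX
    · exact SBranches.size_le_of_mem_reach (by omega) he hM hσ hX
end

/-- The components of `T`, and the unfolding of `T` if it is recursive, belong to `W`. -/
structure SType.StepsInto (W : List SType) (T : SType) : Prop where
  components : T.components ⊆ W
  subst : ∀ S, T = .mu S → (SType.subst (.mu S) 0 S).val ∈ W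

theorem SType.StepsInto.done (W : List SType) : SType.done.StepsInto W :=
  ⟨by simp [SType.components], by simp⟩

mutual
-- A variable stands for a recursive type met higher up, whose steps are already known to stay in
-- `W`; the hypothesis on `σ` carries this knowledge down.
theorem SType.stepsInto_of_mem_reach {W : List SType} {X : SType} : ∀ {T : SType}
    {σ : List SType}, (∀ Y ∈ σ, Y.ClosedBelow 0) → (∀ Y ∈ σ, Y.StepsInto W) → T.reach σ ⊆ W →
      X ∈ T.reach σ → X.StepsInto W
  | .done, σ, hσ, hs, hW, hX => by
    obtain rfl : X = .done := by simpa [SType.reach] using hX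
    exact .done W
  | .inp Ts S, σ, hσ, hs, hW, hX => by
    simp only [SType.reach, List.cons_subset, List.append_subset] at hW
    simp only [SType.reach, List.mem_cons, List.mem_append] at hX
    rcases hX with rfl | hX | hX
    · refine ⟨List.cons_subset.2 ⟨hW.2.2 (S.inst_mem_reach σ), ?_⟩, by simp [SType.inst]⟩
      exact List.Subset.trans (Ts.inst_toList_subset_reach σ) hW.2.1
    · exact STypes.stepsInto_of_mem_reach hσ hs hW.2.1 hX
    · exact SType.stepsInto_of_mem_reach hσ hs hW.2.2 hX
  | .out Ts S, σ, hσ, hs, hW, hX => by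
    simp only [SType.reach, List.cons_subset, List.append_subset] at hW
    simp only [SType.reach, List.mem_cons, List.mem_append] at hX
    rcases hX with rfl | hX | hX
    · refine ⟨List.cons_subset.2 ⟨hW.2.2 (S.inst_mem_reach σ), ?_⟩, by simp [SType.inst]⟩
      exact List.Subset.trans (Ts.inst_toList_subset_reach σ) hW.2.1
    · exact STypes.stepsInto_of_mem_reach hσ hs hW.2.1 hX
    · exact SType.stepsInto_of_mem_reach hσ hs hW.2.2 hX
  | .sel Bs, σ, hσ, hs, hW, hX => by
    simp only [SType.reach, List.cons_subset] at hW
    simp only [SType.reach, List.mem_cons] at hX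
    rcases hX with rfl | hX
    · exact ⟨List.Subset.trans (Bs.inst_types_subset_reach σ) hW.2, by simp [SType.inst]⟩
    · exact SBranches.stepsInto_of_mem_reach hσ hs hW.2 hX
  | .bra Bs, σ, hσ, hs, hW, hX => by
    simp only [SType.reach, List.cons_subset] at hW
    simp only [SType.reach, List.mem_cons] at hX
    rcases hX with rfl | hX
    · exact ⟨List.Subset.trans (Bs.inst_types_subset_reach σ) hW.2, by simp [SType.inst]⟩
    · exact SBranches.stepsInto_of_mem_reach hσ hs hW.2 hX
  | .mu S, σ, hσ, hs, hW, hX => by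
    simp only [SType.reach, List.cons_subset] at hW
    simp only [SType.reach, List.mem_cons] at hX
    have key : ((SType.mu S).inst σ 0).StepsInto W := by
      refine ⟨by simp [SType.inst, SType.components], fun S' hS' => ?_⟩
      rw [← hS']
      rw [SType.inst, SType.mu.injEq] at hS'
      -- The unfolding is the body instantiated in the extended environment, which is a member of
      -- the reach of the body.
      rw [← hS', SType.subst_inst hσ]
      exact hW.2 (S.inst_mem_reach _)
    rcases hX with rfl | hX
    · exact key
    · exact SType.stepsInto_of_mem_reach
        (List.forall_mem_cons.2 ⟨SType.inst_closedBelow hσ _ 0, hσ⟩)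
        (List.forall_mem_cons.2 ⟨key, hs⟩) hW.2 hX
  | .var i, σ, hσ, hs, hW, hX => by
    obtain rfl : X = (SType.var i).inst σ 0 := by simpa [SType.reach] using hX
    simpa [SType.inst] using getD_done_property hs (.done W) i
theorem STypes.stepsInto_of_mem_reach {W : List SType} {X : SType} : ∀ {Ts : STypes}
    {σ : List SType}, (∀ Y ∈ σ, Y.ClosedBelow 0) → (∀ Y ∈ σ, Y.StepsInto W) → Ts.reach σ ⊆ W →
      X ∈ Ts.reach σ → X.StepsInto W
  | .nil, σ, hσ, hs, hW, hX => by simp [STypes.reach] at hX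
  | .cons T Ts, σ, hσ, hs, hW, hX => by
    simp only [STypes.reach, List.append_subset] at hW
    rcases List.mem_append.1 hX with hX | hX
    · exact SType.stepsInto_of_mem_reach hσ hs hW.1 hX
    · exact STypes.stepsInto_of_mem_reach hσ hs hW.2 hX
theorem SBranches.stepsInto_of_mem_reach {W : List SType} {X : SType} : ∀ {Bs : SBranches}
    {σ : List SType}, (∀ Y ∈ σ, Y.ClosedBelow 0) → (∀ Y ∈ σ, Y.StepsInto W) → Bs.reach σ ⊆ W →
      X ∈ Bs.reach σ → X.StepsInto W
  | .nil, σ, hσ, hs, hW, hX => by simp [SBranches.reach] at hX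
  | .cons l T Bs, σ, hσ, hs, hW, hX => by
    simp only [SBranches.reach, List.append_subset] at hW
    rcases List.mem_append.1 hX with hX | hX
    · exact SType.stepsInto_of_mem_reach hσ hs hW.1 hX
    · exact SBranches.stepsInto_of_mem_reach hσ hs hW.2 hX
end

theorem unfoldClosed_reach (T U : SType) :
    UnfoldClosed (T.reach [] ++ U.reach []) ((T.size + U.size) ^ (T.size + U.size)) := by
  have hs : ∀ X ∈ T.reach [] ++ U.reach [], X.StepsInto (T.reach [] ++ U.reach []) := by
    intro X hX
    rcases List.mem_append.1 hX with hX | hX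
    · exact SType.stepsInto_of_mem_reach (by simp) (by simp) (List.subset_append_left _ _) hX
    · exact SType.stepsInto_of_mem_reach (by simp) (by simp) (List.subset_append_right _ _) hX
  refine ⟨fun X hX => (hs X hX).components, fun S hS => (hs _ hS).subst S rfl, fun X hX => ?_⟩
  rw [← mul_one (_ ^ _)]
  rcases List.mem_append.1 hX with hX | hX
  · exact SType.size_le_of_mem_reach (by omega) le_rfl le_rfl (by simp) hX
  · exact SType.size_le_of_mem_reach (by omega) le_rfl le_rfl (by simp) hX

-- The upper bound 2^(15 n²)

theorem callCost_le {Z L N : ℕ} (hZ : 1 ≤ Z) (hL : L ≤ Z) (hN : N ≤ Z ^ 2) :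
    1 + callCost Z L N ≤ 2 ^ 6 * Z ^ 5 := by
  have h : ∀ {i : ℕ}, i ≤ 5 → Z ^ i ≤ Z ^ 5 := fun hi => Nat.pow_le_pow_right hZ hi
  have h0 := h (i := 0) (by omega)
  have h1 := h (i := 1) (by omega)
  have h2 := h (i := 2) (by omega)
  have h3 := h (i := 3) (by omega)
  have h4 := h (i := 4) (by omega)
  calc 1 + callCost Z L N
      ≤ 1 + (5 + Z ^ 2 * (4 + 6 * Z + 2 * (Z * (2 + Z * (6 * Z)))) + Z * (6 * Z) +
          (Z * (2 + 3 * Z) + Z)) := by rw [callCost]; gcongr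
    _ = 6 * Z ^ 0 + 3 * Z ^ 1 + 13 * Z ^ 2 + 10 * Z ^ 3 + 12 * Z ^ 5 := by ring
    -- Every power is at most Z ^ 5, and the coefficients add up to 44 ≤ 2 ^ 6.
    _ ≤ _ := by omega

theorem exists_memoRunsIn_of_closed {T U : SType} (hT : T.ClosedBelow 0) (hU : U.ClosedBelow 0) :
    ∃ calls ops : ℕ, MemoRunsIn T U calls ops ∧
      calls + ops ≤ 2 ^ (15 * (T.size + U.size) ^ 2) := by
  have hTW : T ∈ T.reach [] ++ U.reach [] :=
    List.mem_append_left _ (by simpa [hT.inst_eq] using T.inst_mem_reach [])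
  have hUW : U ∈ T.reach [] ++ U.reach [] :=
    List.mem_append_right _ (by simpa [hU.inst_eq] using U.inst_mem_reach [])
  have hW := unfoldClosed_reach T U
  have hlen : (T.reach [] ++ U.reach []).length = T.size + U.size := by
    simp [SType.length_reach]
  have hn : T.size + U.size ≠ 0 := by
    have := T.size_pos
    omega
  generalize T.size + U.size = n at *
  have hpow : n ^ n ≤ 2 ^ n ^ 2 :=
    calc n ^ n ≤ (2 ^ n) ^ n := Nat.pow_le_pow_left n.lt_two_pow_self.le n
      _ = 2 ^ n ^ 2 := by rw [← pow_mul, sq]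
  -- With Z = 2 ^ n ^ 2 all quantities are powers of one number: contexts have length at most Z and
  -- tables at most Z ^ 2.
  have hW' : UnfoldClosed (T.reach [] ++ U.reach []) (2 ^ n ^ 2) :=
    ⟨hW.components, hW.subst, fun X hX => (hW.size_le X hX).trans hpow⟩
  obtain ⟨calls, ops, h1, h2⟩ := exists_memoRunsIn hW' hTW hUW
  refine ⟨calls, ops, h1, h2.trans ?_⟩
  rw [hlen]
  have hL : n * n ≤ 2 ^ n ^ 2 := by
    rw [← sq]
    exact (n ^ 2).lt_two_pow_self.le
  have hZ : 1 ≤ 2 ^ n ^ 2 := Nat.one_le_two_pow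
  have hN : tableBound n ≤ (2 ^ n ^ 2) ^ 2 := by
    rw [tableBound, sq (2 ^ n ^ 2), ← sq n]
    exact Nat.mul_le_mul_right _ (n ^ 2).lt_two_pow_self.le
  have h2Z : 2 ≤ 2 ^ n ^ 2 := Nat.le_self_pow (pow_ne_zero 2 hn) 2
  have hcost := callCost_le hZ hL hN
  rw [mul_comm 15, pow_mul]
  generalize 2 ^ n ^ 2 = Z at *
  calc (1 + Z * tableBound n) * (1 + callCost Z (n * n) (tableBound n))
      ≤ (Z ^ 3 + Z * Z ^ 2) * (2 ^ 6 * Z ^ 5) := by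
        gcongr
        exact Nat.one_le_pow _ _ hZ
    _ = 2 ^ 7 * Z ^ 8 := by ring
    -- The constant factor is absorbed because 2 ≤ Z; this is the source of the exponent 15.
    _ ≤ Z ^ 7 * Z ^ 8 := by gcongr
    _ = Z ^ 15 := by ring

/-! ## A family of types with exponentially many judgements

Checking `rowType p ≤ colType r p` explores the monotone lattice paths that start in `(p, p)`. Each
point of the lattice is a pair of recursive types, so that different paths have different sets of
assumptions. -/

/-- `μX₁.…μXᵣ.end`. -/
def muChain : ℕ → SType
  | 0 => .done
  | r + 1 => .mu (muChain r)

/-- The type that takes a step down for the label `0` and stays in place for the label `1`. -/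
def rowType : ℕ → SType
  | 0 => .bra .nil
  | i + 1 => .mu (.bra (.cons 0 (rowType i) (.cons 1 (.var 0) .nil)))

/-- The type that stays in place for the label `0` and takes a step down for the label `1`, as long
as it can.  A further branch, of size `r + 1`, at the bottom adjusts the size. -/
def colType (r : ℕ) : ℕ → SType
  | 0 => .mu (.bra (.cons 0 (.var 0) (.cons 1 (.var 0) (.cons 2 (muChain r) .nil))))
  | j + 1 => .mu (.bra (.cons 0 (.var 0) (.cons 1 (colType r j) .nil)))

/-- The unfolding of `rowType (i + 1)`. -/
def rowBody (i : ℕ) : SType :=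
  .bra (.cons 0 (rowType i) (.cons 1 (rowType (i + 1)) .nil))

/-- The unfolding of `colType r j`. -/
def colBody (r : ℕ) : ℕ → SType
  | 0 => .bra (.cons 0 (colType r 0) (.cons 1 (colType r 0) (.cons 2 (muChain r) .nil)))
  | j + 1 => .bra (.cons 0 (colType r (j + 1)) (.cons 1 (colType r j) .nil))

theorem muChain_size (r : ℕ) : (muChain r).size = r + 1 := by
  induction r with
  | zero => simp [muChain, SType.size]
  | succ r ih => simp [muChain, SType.size, ih]

theorem muChain_notMuChainTo (r k : ℕ) : (muChain r).NotMuChainTo k := by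
  induction r generalizing k with
  | zero => simp [muChain, SType.NotMuChainTo]
  | succ r ih => simp [muChain, SType.NotMuChainTo, ih]

theorem muChain_isSessionType (r : ℕ) : (muChain r).IsSessionType := by
  induction r with
  | zero =>
    simp [muChain, SType.IsSessionType, SType.ClosedBelow, SType.Contractive, SType.DistinctLabels]
  | succ r ih =>
    obtain ⟨h1, h2, h3⟩ := ih
    simp [muChain, SType.IsSessionType, SType.ClosedBelow, SType.Contractive, SType.DistinctLabels,
      h1.mono (Nat.zero_le 1), h2, h3, muChain_notMuChainTo]

theorem rowType_size (i : ℕ) : (rowType i).size = 3 * i + 1 := by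
  induction i with
  | zero => simp [rowType, SType.size, SBranches.size]
  | succ i ih => simp [rowType, SType.size, SBranches.size, ih]; omega

theorem colType_size (r j : ℕ) : (colType r j).size = 3 * j + r + 5 := by
  induction j with
  | zero => simp [colType, SType.size, SBranches.size, muChain_size]; omega
  | succ j ih => simp [colType, SType.size, SBranches.size, ih]; omega

theorem rowType_injective : Function.Injective rowType := fun i j h => by
  have := congrArg SType.size h
  simp only [rowType_size] at this
  omega

theorem colType_injective (r : ℕ) : Function.Injective (colType r) := fun i j h => by
  have := congrArg SType.size h
  simp only [colType_size] at this
  omega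

theorem rowBody_injective : Function.Injective rowBody := fun i j h =>
  rowType_injective (by simp_all [rowBody])

theorem rowType_ne_rowBody (i j : ℕ) : rowType i ≠ rowBody j := by
  cases i <;> simp [rowType, rowBody]

theorem colType_ne_colBody (r i j : ℕ) : colType r i ≠ colBody r j := by
  cases i <;> cases j <;> simp [colType, colBody]

theorem rowType_isSessionType (i : ℕ) : (rowType i).IsSessionType := by
  induction i with
  | zero =>
    simp [rowType, SType.IsSessionType, SType.ClosedBelow, SType.Contractive, SType.DistinctLabels,
      SBranches.ClosedBelow, SBranches.Contractive, SBranches.DistinctLabels, SBranches.labels]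
  | succ i ih =>
    obtain ⟨h1, h2, h3⟩ := ih
    simp [rowType, SType.IsSessionType, SType.ClosedBelow, SType.Contractive, SType.DistinctLabels,
      SBranches.ClosedBelow, SBranches.Contractive, SBranches.DistinctLabels, SBranches.labels,
      SType.NotMuChainTo, h1.mono (Nat.zero_le 1), h2, h3]

theorem colType_isSessionType (r j : ℕ) : (colType r j).IsSessionType := by
  induction j with
  | zero =>
    obtain ⟨h1, h2, h3⟩ := muChain_isSessionType r
    simp [colType, SType.IsSessionType, SType.ClosedBelow, SType.Contractive, SType.DistinctLabels,
      SBranches.ClosedBelow, SBranches.Contractive, SBranches.DistinctLabels, SBranches.labels,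
      SType.NotMuChainTo, h1.mono (Nat.zero_le 1), h2, h3]
  | succ j ih =>
    obtain ⟨h1, h2, h3⟩ := ih
    simp [colType, SType.IsSessionType, SType.ClosedBelow, SType.Contractive, SType.DistinctLabels,
      SBranches.ClosedBelow, SBranches.Contractive, SBranches.DistinctLabels, SBranches.labels,
      SType.NotMuChainTo, h1.mono (Nat.zero_le 1), h2, h3]

theorem rowType_unfold (i : ℕ) : (rowType (i + 1)).unfold.val = rowBody i := by
  simp [rowType, rowBody, SType.unfold, SType.muCount, SType.unfoldLoop, SType.subst,
    SBranches.subst, (rowType_isSessionType i).1.subst_eq]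

theorem colType_unfold (r j : ℕ) : (colType r j).unfold.val = colBody r j := by
  cases j with
  | zero =>
    simp [colType, colBody, SType.unfold, SType.muCount, SType.unfoldLoop, SType.subst,
      SBranches.subst, (muChain_isSessionType r).1.subst_eq]
  | succ j =>
    simp [colType, colBody, SType.unfold, SType.muCount, SType.unfoldLoop, SType.subst,
      SBranches.subst, (colType_isSessionType r j).1.subst_eq]

theorem premises_rowType_succ (G : List (SType × SType)) (i : ℕ) (U : SType) :
    (premises G (rowType (i + 1)) U).val = some [⟨(rowType (i + 1), U) :: G, rowBody i, U⟩] := by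
  have h := rowType_unfold i
  rw [rowType] at h ⊢
  simp [premises_mu_left, h]

theorem premises_colType (G : List (SType × SType)) {T : SType} (hT : ∀ S, T ≠ .mu S) (r j : ℕ) :
    (premises G T (colType r j)).val = some [⟨(T, colType r j) :: G, T, colBody r j⟩] := by
  have h := colType_unfold r j
  obtain ⟨S, hS⟩ : ∃ S, colType r j = .mu S := by cases j <;> simp [colType]
  rw [hS] at h ⊢
  simp [premises_mu_right G hT, h]

/-- At j = 0 the label 1 leads back to `colType r 0`, in agreement with truncated subtraction. The
padding branch 2 is never looked up, since the left side has only the labels 0 and 1. -/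
theorem premises_rowBody_colBody (G : List (SType × SType)) (r i j : ℕ) :
    (premises G (rowBody i) (colBody r j)).val =
      some [⟨G, rowType i, colType r j⟩, ⟨G, rowType (i + 1), colType r (j - 1)⟩] := by
  cases j <;> simp [rowBody, colBody, premises, branchPremises, SBranches.find]

/-- A branching without branches is below every branching, so a path that exhausts the row index
ends in success. -/
theorem premises_rowType_zero_colBody (G : List (SType × SType)) (r j : ℕ) :
    (premises G (rowType 0) (colBody r j)).val = some [] := by
  cases j <;> simp [rowType, colBody, premises, branchPremises]

theorem memoSubtype_rowType_colType_ne_fail (r d i j : ℕ) (A : List Judgement)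
    (G : List (SType × SType)) : (memoSubtype d A ⟨G, rowType i, colType r j⟩).val ≠ .fail := by
  refine memoSubtype_ne_fail (Q := fun T U =>
    (∃ i j, T = rowType i ∧ U = colType r j) ∨ (∃ i j, T = rowBody i ∧ U = colType r j) ∨
    (∃ i j, T = rowBody i ∧ U = colBody r j) ∨ ∃ j, T = rowType 0 ∧ U = colBody r j)
    ?_ d A (.inl ⟨i, j, rfl, rfl⟩)
  rintro G T U (⟨i, j, rfl, rfl⟩ | ⟨i, j, rfl, rfl⟩ | ⟨i, j, rfl, rfl⟩ | ⟨j, rfl, rfl⟩)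
  · cases i with
    | zero =>
      refine ⟨_, premises_colType G (by simp [rowType]) r j, ?_⟩
      simp
    | succ i =>
      refine ⟨_, premises_rowType_succ G i _, ?_⟩
      simp
  · refine ⟨_, premises_colType G (by simp [rowBody]) r j, ?_⟩
    simp
  · refine ⟨_, premises_rowBody_colBody G r i j, ?_⟩
    simp only [List.mem_cons, List.not_mem_nil, or_false, forall_eq_or_imp, forall_eq]
    exact ⟨.inl ⟨_, _, rfl, rfl⟩, .inl ⟨_, _, rfl, rfl⟩⟩
  · exact ⟨_, premises_rowType_zero_colBody G r j, by simp⟩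

/-! ## Lattice paths -/

/-- The assumptions collected along a lattice path that starts in `(p, p)`.  The steps of a path
are listed from the last one to the first one. -/
def pathCtx (p r : ℕ) : List Bool → List (SType × SType)
  | [] => []
  | _ :: w =>
    (rowBody (p - w.count false - 1), colType r (p - w.count true)) ::
      (rowType (p - w.count false), colType r (p - w.count true)) :: pathCtx p r w

/-- The judgement at the end of a lattice path. -/
def pathJudgement (p r : ℕ) (w : List Bool) : Judgement :=
  ⟨pathCtx p r w, rowType (p - w.count false), colType r (p - w.count true)⟩

theorem exists_of_mem_pathCtx {p r : ℕ} {w : List Bool} {P : SType × SType}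
    (h : P ∈ pathCtx p r w) : ∃ v : List Bool, v.length < w.length ∧
      P.2 = colType r (p - v.count true) ∧
      (P.1 = rowType (p - v.count false) ∨ P.1 = rowBody (p - v.count false - 1)) := by
  induction w with
  | nil => simp [pathCtx] at h
  | cons b w ih =>
    simp only [pathCtx, List.mem_cons] at h
    rcases h with rfl | rfl | h
    · exact ⟨w, by simp, rfl, .inr rfl⟩
    · exact ⟨w, by simp, rfl, .inl rfl⟩
    · obtain ⟨v, hv, h⟩ := ih h
      exact ⟨v, hv.trans (by simp), h⟩

/-- The two indices at a point determine the number of steps taken, as long as nothing is truncated;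
the points recorded along `w` were reached in fewer steps than `v` has. -/
theorem rowType_notMem_pathCtx {p r : ℕ} {w v : List Bool} (hwv : w.length ≤ v.length)
    (hv : v.length ≤ p) :
    (rowType (p - v.count false), colType r (p - v.count true)) ∉ pathCtx p r w := by
  intro h
  obtain ⟨u, hu, h2, h1 | h1⟩ := exists_of_mem_pathCtx h
  · have e1 := rowType_injective h1
    have e2 := colType_injective r h2
    have := List.count_true_add_count_false v
    have := List.count_true_add_count_false u
    omega
  · exact rowType_ne_rowBody _ _ h1

theorem rowBody_notMem_pathCtx {p r : ℕ} {w v : List Bool} (hwv : w.length ≤ v.length)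
    (hv : v.length < p) :
    (rowBody (p - v.count false - 1), colType r (p - v.count true)) ∉ pathCtx p r w := by
  intro h
  obtain ⟨u, hu, h2, h1 | h1⟩ := exists_of_mem_pathCtx h
  · exact rowType_ne_rowBody _ _ h1.symm
  · have e1 := rowBody_injective h1
    have e2 := colType_injective r h2
    have := List.count_true_add_count_false v
    have := List.count_true_add_count_false u
    omega

/-- A step records the point that it leaves, so the newest pairs depend on the earlier path only. By
the number of steps, the newest point of one context can only be the newest point of the other;
removing it on both sides leaves an inclusion of the shorter contexts. -/
theorem pathCtx_subset_of_cons_subset {p r : ℕ} {b b' : Bool} {w w' : List Bool}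
    (hlen : w.length = w'.length) (hw : w.length < p)
    (h : pathCtx p r (b :: w) ⊆ pathCtx p r (b' :: w')) :
    p - w.count false = p - w'.count false ∧ p - w.count true = p - w'.count true ∧
      pathCtx p r w ⊆ pathCtx p r w' := by
  have h0 : (rowType (p - w.count false), colType r (p - w.count true)) ∈
      pathCtx p r (b' :: w') := h (by simp [pathCtx])
  have h1 : p - w.count false = p - w'.count false ∧ p - w.count true = p - w'.count true := by
    simp only [pathCtx, List.mem_cons, Prod.mk.injEq] at h0
    rcases h0 with h0 | h0 | h0
    · exact absurd h0.1 (rowType_ne_rowBody _ _)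
    · exact ⟨rowType_injective h0.1, colType_injective r h0.2⟩
    · exact absurd h0 (rowType_notMem_pathCtx hlen.ge hw.le)
  refine ⟨h1.1, h1.2, fun P hP => ?_⟩
  have hP' : P ∈ pathCtx p r (b' :: w') := h (by simp [pathCtx, hP])
  rw [pathCtx, ← h1.1, ← h1.2] at hP'
  rcases List.mem_cons.1 hP' with rfl | hP'
  · exact absurd hP (rowBody_notMem_pathCtx le_rfl hw)
  rcases List.mem_cons.1 hP' with rfl | hP'
  · exact absurd hP (rowType_notMem_pathCtx le_rfl hw.le)
  · exact hP'

theorem eq_of_pathJudgement_equiv {p r : ℕ} {w w' : List Bool} (hlen : w.length = w'.length)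
    (hw : w.length ≤ p) (h : (pathJudgement p r w).Equiv (pathJudgement p r w')) : w = w' := by
  induction w generalizing w' with
  | nil => exact (List.length_eq_zero_iff.1 hlen.symm).symm
  | cons b w ih =>
    obtain _ | ⟨b', w'⟩ := w'
    · simp at hlen
    simp only [List.length_cons, Nat.add_right_cancel_iff] at hlen hw
    obtain ⟨h1, -, h3, h4⟩ := h
    obtain ⟨e1, e2, h5⟩ := pathCtx_subset_of_cons_subset (b := b) (b' := b') hlen hw h3
    obtain ⟨-, -, h6⟩ := pathCtx_subset_of_cons_subset (b := b') (b' := b) hlen.symm (hlen ▸ hw) h4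
    obtain rfl := ih hlen (by omega) ⟨congrArg rowType e1, congrArg (colType r) e2, h5, h6⟩
    have h1 := rowType_injective h1
    have := List.count_true_add_count_false w
    -- The last step is not recorded in the context; it is read off from the row index at the end
    -- point.
    cases b <;> cases b' <;> simp at h1 ⊢ <;> omega

-- All lattice paths occur in the memo table

/-- The table contains the premises of all its judgements that do not hold by assumption, up to
equivalence. -/
def ClosedTable (A : List Judgement) : Prop :=
  ∀ K ∈ A, (K.lhs, K.rhs) ∈ K.ctx ∨
    ∃ Js, (premises K.ctx K.lhs K.rhs).val = some Js ∧ ∀ J ∈ Js, ∃ J' ∈ A, J.Equiv J'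

/-- The table may hold the judgement with another representation `G'` of its context. The rules only
prepend pairs to the context, which `L` records uniformly in the context, so the premises over `G`
and `G'` are equivalent as well. -/
theorem ClosedTable.premise {A : List Judgement} (hA : ClosedTable A) {G : List (SType × SType)}
    {T U : SType} (hmem : ∃ K ∈ A, (Judgement.mk G T U).Equiv K) (hTU : (T, U) ∉ G)
    {L : List (List (SType × SType) × SType × SType)}
    (hL : ∀ G, (premises G T U).val = some (L.map fun x => ⟨x.1 ++ G, x.2.1, x.2.2⟩))
    {x : List (SType × SType) × SType × SType} (hx : x ∈ L) :
    ∃ K ∈ A, (Judgement.mk (x.1 ++ G) x.2.1 x.2.2).Equiv K := by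
  obtain ⟨⟨G', T', U'⟩, hK, rfl, rfl, h1, h2⟩ := hmem
  rcases hA _ hK with h | ⟨Js, h3, h4⟩
  · exact absurd (h2 h) hTU
  · rw [hL, Option.some.injEq] at h3
    obtain ⟨K, hK, h5⟩ := h4 ⟨x.1 ++ G', x.2.1, x.2.2⟩ (h3 ▸ List.mem_map_of_mem hx)
    refine ⟨K, hK, .trans (K := ⟨x.1 ++ G', x.2.1, x.2.2⟩) ⟨rfl, rfl, ?_, ?_⟩ h5⟩
    · exact List.append_subset.2
        ⟨List.subset_append_left _ _, List.subset_append_of_subset_right _ h1⟩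
    · exact List.append_subset.2
        ⟨List.subset_append_left _ _, List.subset_append_of_subset_right _ h2⟩

theorem ClosedTable.exists_pathJudgement {A : List Judgement} (hA : ClosedTable A) {p r : ℕ}
    (h0 : ∃ K ∈ A, (Judgement.mk [] (rowType p) (colType r p)).Equiv K) {w : List Bool}
    (hw : w.length ≤ p) : ∃ K ∈ A, (pathJudgement p r w).Equiv K := by
  induction w with
  | nil => simpa [pathJudgement, pathCtx] using h0
  | cons b w ih =>
    rw [List.length_cons, Nat.succ_le_iff] at hw
    have hcount := List.count_true_add_count_false w
    -- Fewer than p steps have been taken, so the row type is still recursive. One lattice step is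
    -- then three rules: unfold on the left (`s1`), unfold on the right (`s2`), branch (`s3`).
    obtain ⟨i, hi⟩ : ∃ i, p - w.count false = i + 1 := ⟨p - w.count false - 1, by omega⟩
    have hi' : p - w.count false - 1 = i := by omega
    have n1 := rowType_notMem_pathCtx (r := r) (le_refl w.length) hw.le
    have n2 := rowBody_notMem_pathCtx (r := r) (le_refl w.length) hw
    have ih := ih hw.le
    rw [pathJudgement, hi] at ih
    rw [hi] at n1
    rw [hi'] at n2
    have s1 := hA.premise ih n1
      (L := [([(rowType (i + 1), colType r (p - w.count true))], rowBody i, _)])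
      (fun G => by rw [premises_rowType_succ]; rfl) List.mem_cons_self
    have s2 := hA.premise s1
      (L := [([(rowBody i, colType r (p - w.count true))], rowBody i,
        colBody r (p - w.count true))])
      (by
        simp only [List.singleton_append, List.mem_cons, not_or]
        exact ⟨by simp [(rowType_ne_rowBody _ _).symm], n2⟩)
      (fun G => by rw [premises_colType G (by simp [rowBody])]; rfl) List.mem_cons_self
    have n3 : (rowBody i, colBody r (p - w.count true)) ∉
        pathCtx p r (b :: w) := by
      -- All right-hand sides in the context are recursive types, which `colBody` is not.
      intro h
      obtain ⟨v, -, h, -⟩ := exists_of_mem_pathCtx h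
      exact colType_ne_colBody _ _ _ h.symm
    rw [pathCtx, hi, Nat.add_sub_cancel] at n3
    have s3 := @ClosedTable.premise A hA _ _ _ s2 n3
      [([], rowType i, colType r (p - w.count true)),
        ([], rowType (i + 1), colType r (p - w.count true - 1))]
      (fun G => by rw [premises_rowBody_colBody]; rfl)
    rw [pathJudgement, pathCtx, hi, Nat.add_sub_cancel]
    cases b with
    | false =>
      have := s3 List.mem_cons_self
      simpa [show p - (w.count false + 1) = i by omega] using this
    | true =>
      have := s3 (List.mem_cons_of_mem _ List.mem_cons_self)
      simpa [hi, Nat.sub_sub] using this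

theorem ClosedTable.two_pow_le_length {A : List Judgement} (hA : ClosedTable A) {p r : ℕ}
    (h0 : ∃ K ∈ A, (Judgement.mk [] (rowType p) (colType r p)).Equiv K) : 2 ^ p ≤ A.length := by
  have h : ∀ v : Fin p → Bool, ∃ k : Fin A.length,
      (pathJudgement p r (List.ofFn v)).Equiv (A.get k) := fun v => by
    obtain ⟨K, hK, hv⟩ := hA.exists_pathJudgement h0 (w := List.ofFn v) (by simp)
    obtain ⟨k, rfl⟩ := List.get_of_mem hK
    exact ⟨k, hv⟩
  choose f hf using h
  have hinj : Function.Injective f := fun v v' hvv => List.ofFn_injective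
    (eq_of_pathJudgement_equiv (by simp) (by simp) ((hf v).trans (hvv ▸ (hf v').symm)))
  simpa using Fintype.card_le_of_injective f hinj

/-- The run starts with the empty table, so the whole final table is new and is no longer than the
number of calls. -/
theorem two_pow_le_calls {p r calls ops : ℕ}
    (h : MemoRunsIn (rowType p) (colType r p) calls ops) : 2 ^ p ≤ calls := by
  obtain ⟨d, R, hR, hd⟩ := h
  have hfail := memoSubtype_rowType_colType_ne_fail r d p p [] []
  have hsat := fun A => memoSubtype_saturates d (A := []) (A' := A) (J := ⟨[], rowType p, colType r p⟩)
  rw [hd] at hfail hsat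
  cases R with
  | ok A =>
    obtain ⟨⟨B, h1, h2, h3⟩, h4⟩ := hsat A rfl
    obtain rfl : A = B := by simpa using h1
    exact (ClosedTable.two_pow_le_length h3 h4).trans h2
  | fail => exact absurd rfl hfail
  | depthExceeded => exact absurd rfl hR

/-! ## Comparison with the Gamma function -/

/-- With s = ⌊√n⌋, (s + 1)! ≤ (s + 1)^(s + 1), whose logarithm is of order √n log n, against an
exponent of about n / 6. Taking 12th powers turns the comparison into (s + 1)^12 ≤ 2^(s + 1), which
holds for large s. -/
theorem gamma_sqrt_le_two_pow :
    ∃ N : ℕ, ∀ n ≥ N, Real.Gamma (Real.sqrt n + 1) ≤ 2 ^ ((n - 6) / 6) := by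
  have hlim := tendsto_pow_const_div_const_pow_of_one_lt 12 (one_lt_two : (1 : ℝ) < 2)
  obtain ⟨M, hM⟩ := Filter.eventually_atTop.1 (hlim.eventually_le_const one_pos)
  refine ⟨M ^ 2 + 49, fun n hn => ?_⟩
  set s := Nat.sqrt n with hs
  have hMs : M ≤ s := Nat.le_sqrt'.2 (by omega)
  have h7 : 7 ≤ s := Nat.le_sqrt'.2 (by omega)
  have hsn : s * s ≤ n := Nat.sqrt_le n
  have hpow : ((s + 1 : ℕ) : ℝ) ^ 12 ≤ 2 ^ (s + 1) := by
    have := hM (s + 1) (by omega)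
    rwa [div_le_one (by positivity)] at this
  have hpow : (s + 1) ^ 12 ≤ 2 ^ (s + 1) := by exact_mod_cast hpow
  -- The right side is at least 2 * n - 22 after rounding, hence at least 2 * s ^ 2 - 22; s ≥ 7
  -- suffices.
  have hexp : (s + 1) * (s + 1) ≤ 12 * ((n - 6) / 6) := by
    have : 7 * s ≤ s * s := Nat.mul_le_mul_right s h7
    have : (s + 1) * (s + 1) = s * s + 2 * s + 1 := by ring
    omega
  have hfac : (s + 1).factorial ≤ 2 ^ ((n - 6) / 6) := by
    refine (Nat.pow_le_pow_iff_left (n := 12) (by norm_num)).1 ?_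
    calc (s + 1).factorial ^ 12 ≤ ((s + 1) ^ (s + 1)) ^ 12 :=
          Nat.pow_le_pow_left (Nat.factorial_le_pow _) _
      _ = ((s + 1) ^ 12) ^ (s + 1) := by rw [← pow_mul, ← pow_mul, mul_comm]
      _ ≤ (2 ^ (s + 1)) ^ (s + 1) := Nat.pow_le_pow_left hpow _
      _ = 2 ^ ((s + 1) * (s + 1)) := by rw [pow_mul]
      _ ≤ 2 ^ (12 * ((n - 6) / 6)) := Nat.pow_le_pow_right two_pos hexp
      _ = (2 ^ ((n - 6) / 6)) ^ 12 := by rw [mul_comm, pow_mul]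
  have hsqrt : Real.sqrt n ≤ s + 1 := Real.real_sqrt_le_nat_sqrt_succ
  -- Monotonicity of the Gamma function is used on [2, ∞), so the argument √n + 1 must be at least
  -- 2.
  have h1 : 1 ≤ Real.sqrt n := Real.one_le_sqrt.2 (by norm_cast; omega)
  calc Real.Gamma (Real.sqrt n + 1) ≤ Real.Gamma ((s + 1 : ℕ) + 1) :=
        Real.Gamma_strictMonoOn_Ici.monotoneOn (Set.mem_Ici.2 (by linarith))
          (Set.mem_Ici.2 (by push_cast; linarith)) (by push_cast; linarith)
    _ = (s + 1).factorial := Real.Gamma_nat_eq_factorial _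
    _ ≤ 2 ^ ((n - 6) / 6) := by exact_mod_cast hfac

theorem mainTheorem5 :
    (∃ C : ℕ, ∀ T U : SType, T.IsSessionType → U.IsSessionType →
      ∃ calls ops : ℕ, MemoRunsIn T U calls ops ∧
        calls + ops ≤ 2 ^ (C * (T.size + U.size) ^ 2)) ∧
    (∃ c : ℝ, 0 < c ∧ ∃ N : ℕ, ∀ n : ℕ, N ≤ n →
      ∃ T U : SType, T.IsSessionType ∧ U.IsSessionType ∧ T.size + U.size = n ∧
        ∃ calls ops : ℕ, MemoRunsIn T U calls ops ∧
          c * Real.Gamma (Real.sqrt n + 1) ≤ calls) := by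
  refine ⟨⟨15, fun T U hT hU => exists_memoRunsIn_of_closed hT.1 hU.1⟩, 1, one_pos, ?_⟩
  obtain ⟨N, hN⟩ := gamma_sqrt_le_two_pow
  refine ⟨N + 6, fun n hn => ?_⟩
  -- The sizes add up to 6 * p + 6 + r, so quotient and remainder of n - 6 by 6 realize every n ≥ 6
  -- exactly.
  set p := (n - 6) / 6 with hp
  set r := (n - 6) % 6 with hr
  have hT := rowType_isSessionType p
  have hU := colType_isSessionType r p
  obtain ⟨calls, ops, h, -⟩ := exists_memoRunsIn_of_closed hT.1 hU.1
  refine ⟨_, _, hT, hU, by rw [rowType_size, colType_size]; omega, calls, ops, h, ?_⟩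
  rw [one_mul]
  exact (hN n (by omega)).trans (by exact_mod_cast two_pow_le_calls h)
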